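/- Let $F$ be an efficient field: its elements are encoded by bit strings so that the field operations, and Gaussian elimination (bringing a given matrix over $F$ into a row echelon form by an invertible row transformation), can be carried out in polynomial time in the size of the input encoding. Let $d \ge 0$ be a fixed integer. An instance $(L,V)$ of $d$-Polynomial root CSP over $F$ consists of variables $V = \{x_1,\dots,x_n\}$ and a list $L$ of constraints $f(x_1,\dots,x_n) = 0$, where each $f$ is a polynomial over $F$ of degree at most $d$, written as a sum of terms; the question is whether some assignment $\tau\colon V \to \{0,1\}$ satisfies all constraints in $L$. Then there is a polynomial-time algorithm that, given such an instance $(L,V)$, outputs an instance $(L',V)$ such that 1. $L'$ is a sublist of $L$; 2. $L'$ has at most $n^d + 1$ constraints; 3. $(L',V)$ is equivalent to $(L,V)$: one of them has a satisfying assignment if and only if the other one has; 4. the rows of the constraints in $L'$ form a basis of the row space of the matrix $A$ that has one row for every constraint of $L$ and one column for every multilinear monomial of degree at most $d$ in the variables $V$, and whose entries are the coefficients of the polynomials $f$ after every power $x_i^c$ with $c \ge 1$ has been replaced by $x_i$. -/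

import Mathlib

/-! ## A machine model with a step count

The data are binary trees, the data structure of pure Lisp. A program is built from the
primitive operations "build a cell", "first component", "second component", by composition,
branching on whether a value is `nil`, and unbounded loops. Every primitive operation, every
composition, every test and every pass of a loop costs one step. -/

namespace TreeMachine

/-- Binary trees: `nil`, or a cell with two components. -/
inductive Val : Type
  | nil : Val
  | cons : Val → Val → Val

namespace Val

/-- First component of a cell (`nil` on `nil`). -/
def hd : Val → Val
  | nil => nil
  | cons a _ => a

/-- Second component of a cell (`nil` on `nil`). -/
def tl : Val → Val
  | nil => nil
  | cons _ b => b

/-- Size of a tree: the number of its nodes. -/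
def size : Val → ℕ
  | nil => 1
  | cons a b => size a + size b + 1

end Val

/-- Programs. Each of them maps a tree to a tree (if it terminates). -/
inductive Prog : Type
  /-- return the input -/
  | ident : Prog
  /-- return `nil` -/
  | nil : Prog
  /-- first component of the input -/
  | hd : Prog
  /-- second component of the input -/
  | tl : Prog
  /-- run both programs on the input and build a cell from the two results -/
  | pair : Prog → Prog → Prog
  /-- run the first program, then the second one on its result -/
  | seq : Prog → Prog → Prog
  /-- `cond c p q`: run `c`; if its result is not `nil`, run `p` on the input, otherwise `q` -/
  | cond : Prog → Prog → Prog → Prog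
  /-- `loop c b`: as long as the result of `c` on the current value is not `nil`,
  replace the current value by the result of `b` on it -/
  | loop : Prog → Prog → Prog

/-- `Runs p x y t`: the program `p`, started on `x`, halts with result `y` after `t` steps. -/
inductive Runs : Prog → Val → Val → ℕ → Prop
  | ident (x : Val) : Runs Prog.ident x x 1
  | nil (x : Val) : Runs Prog.nil x Val.nil 1
  | hd (x : Val) : Runs Prog.hd x x.hd 1
  | tl (x : Val) : Runs Prog.tl x x.tl 1
  | pair {p q : Prog} {x y z : Val} {s t : ℕ} :
      Runs p x y s → Runs q x z t → Runs (Prog.pair p q) x (Val.cons y z) (s + t + 1)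
  | seq {p q : Prog} {x y z : Val} {s t : ℕ} :
      Runs p x y s → Runs q y z t → Runs (Prog.seq p q) x z (s + t + 1)
  | cond_cons {c p q : Prog} {x a b y : Val} {s t : ℕ} :
      Runs c x (Val.cons a b) s → Runs p x y t → Runs (Prog.cond c p q) x y (s + t + 1)
  | cond_nil {c p q : Prog} {x y : Val} {s t : ℕ} :
      Runs c x Val.nil s → Runs q x y t → Runs (Prog.cond c p q) x y (s + t + 1)
  | loop_nil {c b : Prog} {x : Val} {s : ℕ} :
      Runs c x Val.nil s → Runs (Prog.loop c b) x x (s + 1)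
  | loop_cons {c b : Prog} {x u v y z : Val} {s t r : ℕ} :
      Runs c x (Val.cons u v) s → Runs b x y t → Runs (Prog.loop c b) y z r →
        Runs (Prog.loop c b) x z (s + t + r + 1)

/-- The model is deterministic: a program has at most one result and one running time on
each input. -/
theorem Runs.unique {p : Prog} {x y : Val} {t : ℕ} (h : Runs p x y t) :
    ∀ {y' : Val} {t' : ℕ}, Runs p x y' t' → y = y' ∧ t = t' := by
  induction h with
  | ident x => intro y' t' h'; cases h'; exact ⟨rfl, rfl⟩
  | nil x => intro y' t' h'; cases h'; exact ⟨rfl, rfl⟩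
  | hd x => intro y' t' h'; cases h'; exact ⟨rfl, rfl⟩
  | tl x => intro y' t' h'; cases h'; exact ⟨rfl, rfl⟩
  | pair _ _ ih1 ih2 =>
    intro y' t' h'
    cases h' with
    | pair h1 h2 =>
      obtain ⟨rfl, rfl⟩ := ih1 h1
      obtain ⟨rfl, rfl⟩ := ih2 h2
      exact ⟨rfl, rfl⟩
  | seq _ _ ih1 ih2 =>
    intro y' t' h'
    cases h' with
    | seq h1 h2 =>
      obtain ⟨rfl, rfl⟩ := ih1 h1
      obtain ⟨rfl, rfl⟩ := ih2 h2
      exact ⟨rfl, rfl⟩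
  | cond_cons _ _ ih1 ih2 =>
    intro y' t' h'
    cases h' with
    | cond_cons h1 h2 =>
      obtain ⟨_, rfl⟩ := ih1 h1
      obtain ⟨rfl, rfl⟩ := ih2 h2
      exact ⟨rfl, rfl⟩
    | cond_nil h1 h2 => exact absurd (ih1 h1).1 (by simp)
  | cond_nil _ _ ih1 ih2 =>
    intro y' t' h'
    cases h' with
    | cond_cons h1 h2 => exact absurd (ih1 h1).1 (by simp)
    | cond_nil h1 h2 =>
      obtain ⟨_, rfl⟩ := ih1 h1
      obtain ⟨rfl, rfl⟩ := ih2 h2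
      exact ⟨rfl, rfl⟩
  | loop_nil _ ih1 =>
    intro y' t' h'
    cases h' with
    | loop_nil h1 =>
      obtain ⟨_, rfl⟩ := ih1 h1
      exact ⟨rfl, rfl⟩
    | loop_cons h1 h2 h3 => exact absurd (ih1 h1).1 (by simp)
  | loop_cons _ _ _ ih1 ih2 ih3 =>
    intro y' t' h'
    cases h' with
    | loop_nil h1 => exact absurd (ih1 h1).1 (by simp)
    | loop_cons h1 h2 h3 =>
      obtain ⟨_, rfl⟩ := ih1 h1
      obtain ⟨rfl, rfl⟩ := ih2 h2
      obtain ⟨rfl, rfl⟩ := ih3 h3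
      exact ⟨rfl, rfl⟩

/-- `f` is computable in polynomial time, with respect to the encodings `ea` and `eb` of its
inputs and outputs: some program computes it so that the number of steps plus the size of the
output is bounded by a polynomial in the size of the input. (Cells are shared and not copied, so
a tree can have more nodes than the number of steps that built it; for that reason the size of
the output is charged, too. Shared trees can be simulated by a Turing machine with polynomial
overhead and vice versa, so this is the usual notion of polynomial time.) -/
def PolyTime {α β : Type*} (ea : α → Val) (eb : β → Val) (f : α → β) : Prop :=
  ∃ (p : Prog) (P : Polynomial ℕ), ∀ a : α, ∃ t : ℕ,
    Runs p (ea a) (eb (f a)) t ∧ t + (eb (f a)).size ≤ P.eval (ea a).size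

/-! ### Encodings -/

/-- A list is encoded by the nested cells of the codes of its entries. -/
def encodeList {α : Type*} (e : α → Val) : List α → Val
  | [] => Val.nil
  | a :: l => Val.cons (e a) (encodeList e l)

/-- A pair is encoded by a cell. -/
def encodePair {α β : Type*} (ea : α → Val) (eb : β → Val) (x : α × β) : Val :=
  Val.cons (ea x.1) (eb x.2)

/-- The two bits are `nil` and the cell of two `nil`s. -/
def encodeBit : Bool → Val
  | false => Val.nil
  | true => Val.cons Val.nil Val.nil

/-- Natural numbers (dimensions, numbers of variables, indices of variables) are encoded in
unary. -/
def encodeNat (n : ℕ) : Val :=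
  encodeList (fun _ : Unit => Val.nil) (List.replicate n ())

/-- A field element is encoded by a bit string. -/
def encodeElem {F : Type*} (enc : Computability.Encoding F Bool) (a : F) : Val :=
  encodeList encodeBit (enc.encode a)

end TreeMachine

/-! ## Efficient fields -/

namespace EfficientField

open TreeMachine

/-- Matrices over `F` of arbitrary dimensions. -/
structure Mat (F : Type*) where
  /-- number of rows -/
  rows : ℕ
  /-- number of columns -/
  cols : ℕ
  /-- the matrix -/
  entries : Matrix (Fin rows) (Fin cols) F

/-- A matrix is encoded by its dimensions and the list of its rows. -/
def encodeMat {F : Type*} (enc : Computability.Encoding F Bool) (A : Mat F) : Val :=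
  Val.cons (encodeNat A.rows) (Val.cons (encodeNat A.cols)
    (encodeList (encodeList (encodeElem enc))
      (List.ofFn fun i => List.ofFn fun j => A.entries i j)))

/-- `g` performs Gaussian elimination: it brings every matrix into a row echelon form, by an
invertible row transformation. -/
def IsGaussianElimination {F : Type*} [Field F]
    (g : ∀ m n : ℕ, Matrix (Fin m) (Fin n) F → Matrix (Fin m) (Fin n) F) : Prop :=
  ∀ (m n : ℕ) (A : Matrix (Fin m) (Fin n) F), (g m n A).IsRowEchelon ∧
    ∃ P : Matrix (Fin m) (Fin m) F, IsUnit P ∧ g m n A = P * A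

/-- A field, with an encoding of its elements by bit strings, is efficient if the field
operations and Gaussian elimination can be done in polynomial time. -/
structure IsEfficient {F : Type*} [Field F] (enc : Computability.Encoding F Bool) : Prop where
  add : PolyTime (encodePair (encodeElem enc) (encodeElem enc)) (encodeElem enc)
    (fun x : F × F => x.1 + x.2)
  neg : PolyTime (encodeElem enc) (encodeElem enc) (fun a : F => -a)
  mul : PolyTime (encodePair (encodeElem enc) (encodeElem enc)) (encodeElem enc)
    (fun x : F × F => x.1 * x.2)
  inv : PolyTime (encodeElem enc) (encodeElem enc) (fun a : F => a⁻¹)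
  gauss : ∃ g : ∀ m n : ℕ, Matrix (Fin m) (Fin n) F → Matrix (Fin m) (Fin n) F,
    IsGaussianElimination g ∧
      PolyTime (encodeMat enc) (encodeMat enc)
        (fun A : Mat F => ⟨A.rows, A.cols, g A.rows A.cols A.entries⟩)

end EfficientField

/-! ## Polynomial root CSP -/

namespace PolyRootCSP

open TreeMachine

/-- A polynomial in `n` variables, written as a list of terms: a coefficient and a list of
variables, to be multiplied (with repetitions for higher powers). -/
abbrev PolyExpr (F : Type*) (n : ℕ) : Type _ := List (F × List (Fin n))

/-- The polynomial that a list of terms denotes. -/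
noncomputable def PolyExpr.toPoly {F : Type*} [Field F] {n : ℕ} (p : PolyExpr F n) :
    MvPolynomial (Fin n) F :=
  (p.map fun t => MvPolynomial.C t.1 * (t.2.map MvPolynomial.X).prod).sum

/-- A constraint `f = 0`, given by a polynomial `f` of degree at most `d`. -/
structure Constraint (F : Type*) [Field F] (d n : ℕ) where
  /-- the polynomial as it is written in the instance -/
  expr : PolyExpr F n
  /-- the polynomial has degree at most `d` -/
  degree_le : expr.toPoly.totalDegree ≤ d

/-- The polynomial of a constraint. -/
noncomputable def Constraint.poly {F : Type*} [Field F] {d n : ℕ} (f : Constraint F d n) :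
    MvPolynomial (Fin n) F :=
  f.expr.toPoly

/-- An instance: the number `n` of variables and a list of constraints over them. -/
structure Inst (F : Type*) [Field F] (d : ℕ) where
  /-- number of variables -/
  numVars : ℕ
  /-- the list of constraints -/
  constraints : List (Constraint F d numVars)

/-- A 0/1-assignment satisfies `f = 0` if it is a root of `f`. -/
def Satisfies {F : Type*} [Field F] {d n : ℕ} (τ : Fin n → Bool) (f : Constraint F d n) : Prop :=
  MvPolynomial.eval (fun i => if τ i then (1 : F) else 0) f.poly = 0

/-- Some 0/1-assignment satisfies all constraints in the list. -/
def Satisfiable {F : Type*} [Field F] {d n : ℕ} (L : List (Constraint F d n)) : Prop :=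
  ∃ τ : Fin n → Bool, ∀ f ∈ L, Satisfies τ f

/-- A constraint is encoded by the list of its terms. -/
def encodeConstraint {F : Type*} [Field F] (enc : Computability.Encoding F Bool) {d n : ℕ}
    (f : Constraint F d n) : Val :=
  encodeList (encodePair (encodeElem enc) (encodeList fun v : Fin n => encodeNat v)) f.expr

/-- An instance is encoded by the number of variables and the list of constraints. -/
def encodeInst {F : Type*} [Field F] (enc : Computability.Encoding F Bool) {d : ℕ}
    (I : Inst F d) : Val :=
  Val.cons (encodeNat I.numVars) (encodeList (encodeConstraint enc) I.constraints)

/-- The row of a constraint in the coefficient matrix over multilinear monomials: `x ^ c` is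
replaced by `x` for `c ≥ 1`, and the coefficients of all monomials that become the product of the
variables in `S` are added up. The columns are the sets `S` of at most `d` variables. -/
noncomputable def multilinearRow {F : Type*} [Field F] {d n : ℕ} (f : Constraint F d n) :
    {S : Finset (Fin n) // S.card ≤ d} → F :=
  fun S => ∑ e ∈ f.poly.support with e.support = S.1, f.poly.coeff e

/-- The rows of the constraints in `L'` form a basis of the row space of the coefficient matrix
of `L`. -/
def IsRowBasis {F : Type*} [Field F] {d n : ℕ} (L' L : List (Constraint F d n)) : Prop :=
  LinearIndependent F (fun i : Fin L'.length => multilinearRow (L'.get i)) ∧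
    Submodule.span F (Set.range fun i : Fin L'.length => multilinearRow (L'.get i)) =
      Submodule.span F (Set.range fun i : Fin L.length => multilinearRow (L.get i))

end PolyRootCSP

/-!
The constraints that do not depend linearly on earlier ones form a basis of the row space
(`List.greedyBasis_spec`). The value of a constraint at a 0/1-assignment is a linear function of
its row (`eval_eq_sum_multilinearRow`), so this basis has the same satisfying assignments as the
whole list, and its length is at most the number of sets of at most `d` variables, which is at most
`n ^ d + 1`.

It remains to find this greedy basis in polynomial time. Gaussian elimination of the transposed
coefficient matrix shows it: in a row echelon form, the pivot columns are the columns that do not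
depend on those to their left (`Matrix.exists_isLeadingEntry_mul_iff`). The entries of the
coefficient matrix, however, are sums of coefficients, and an efficient field only promises that a
single addition takes polynomial time: the codes might explode in a long sum. The matrix is
therefore never computed. Let `D` have a row for each occurrence of a term and a column for each
constraint, with the coefficient of the term in the column of its constraint, and let the
0/1-matrix `E` tell which occurrences of terms have the same set of variables. Then the column of
`E * D` for a constraint lists its multilinear coefficients, with repetitions and without some zero
entries (`sameVarsMatrix_mul_termMatrix`), and `- E * D` is the Schur complement of the block `1`
in the matrix with rows `1, D` and `E, 0`. Hence the pivots of this matrix to the right of the block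
`1` mark the greedy basis (`Matrix.col_schurBlock_mem_span_iff`, `selectPivots_natTerms`), and its
entries are given coefficients, zeros and ones. Taking the columns from the instance also spares an
enumeration of the monomials, so that the algorithm does not depend on `d`.

For the running time, polynomial time is shown to be closed under composition, pairing, branching
and, as long as the size of the state stays polynomial, loops over lists (`PolyTime.foldl`). All
steps of the algorithm are built from these.
-/

namespace TreeMachine

/-! ### Polynomial bounds -/

theorem eval_nat_mono (P : Polynomial ℕ) {m n : ℕ} (h : m ≤ n) : P.eval m ≤ P.eval n := by
  induction P using Polynomial.induction_on' with
  | add p q hp hq => simpa using add_le_add hp hq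
  | monomial k c => simpa using Nat.mul_le_mul_left c (Nat.pow_le_pow_left h k)

/-- The function `u` is bounded by a polynomial in the size of the code of its argument. -/
def PolyBounded {α : Type*} (ea : α → Val) (u : α → ℕ) : Prop :=
  ∃ P : Polynomial ℕ, ∀ a, u a ≤ P.eval (ea a).size

section PolyBounded

variable {α β : Type*} {ea : α → Val} {eb : β → Val} {u v : α → ℕ}

theorem PolyBounded.mono (hv : PolyBounded ea v) (h : ∀ a, u a ≤ v a) : PolyBounded ea u := by
  obtain ⟨P, hP⟩ := hv
  exact ⟨P, fun a => (h a).trans (hP a)⟩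

theorem PolyBounded.const (c : ℕ) : PolyBounded ea fun _ => c :=
  ⟨Polynomial.C c, fun a => by simp⟩

theorem PolyBounded.size : PolyBounded ea fun a => (ea a).size :=
  ⟨Polynomial.X, fun a => by simp⟩

theorem PolyBounded.add (hu : PolyBounded ea u) (hv : PolyBounded ea v) :
    PolyBounded ea fun a => u a + v a := by
  obtain ⟨P, hP⟩ := hu
  obtain ⟨Q, hQ⟩ := hv
  exact ⟨P + Q, fun a => by simpa using add_le_add (hP a) (hQ a)⟩

theorem PolyBounded.mul (hu : PolyBounded ea u) (hv : PolyBounded ea v) :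
    PolyBounded ea fun a => u a * v a := by
  obtain ⟨P, hP⟩ := hu
  obtain ⟨Q, hQ⟩ := hv
  exact ⟨P * Q, fun a => by simpa using Nat.mul_le_mul (hP a) (hQ a)⟩

theorem PolyBounded.eval (P : Polynomial ℕ) (hu : PolyBounded ea u) :
    PolyBounded ea fun a => P.eval (u a) := by
  obtain ⟨Q, hQ⟩ := hu
  exact ⟨P.comp Q, fun a => by simpa using eval_nat_mono P (hQ a)⟩

theorem PolyBounded.comp {w : β → ℕ} (hw : PolyBounded eb w) {f : α → β}
    (hf : PolyBounded ea fun a => (eb (f a)).size) : PolyBounded ea fun a => w (f a) := by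
  obtain ⟨P, hP⟩ := hw
  exact (PolyBounded.eval P hf).mono fun a => hP (f a)

end PolyBounded

/-! ### Closure properties of polynomial time -/

section Basic

variable {α β γ : Type*} {ea : α → Val} {eb : β → Val} {ec : γ → Val}

/-- The running time as a function of the input, and separate bounds for the running time and for
the size of the output. -/
theorem polyTime_iff {f : α → β} : PolyTime ea eb f ↔
    ∃ (p : Prog) (t : α → ℕ), (∀ a, Runs p (ea a) (eb (f a)) (t a)) ∧ PolyBounded ea t ∧
      PolyBounded ea fun a => (eb (f a)).size := by
  constructor
  · rintro ⟨p, P, h⟩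
    choose t h1 h2 using h
    exact ⟨p, t, h1, ⟨P, fun a => (Nat.le_add_right _ _).trans (h2 a)⟩,
      ⟨P, fun a => (Nat.le_add_left _ _).trans (h2 a)⟩⟩
  · rintro ⟨p, t, h, h1, h2⟩
    obtain ⟨P, hP⟩ := h1.add h2
    exact ⟨p, P, fun a => ⟨t a, h a, hP a⟩⟩

theorem PolyTime.size_le {f : α → β} (hf : PolyTime ea eb f) :
    PolyBounded ea fun a => (eb (f a)).size := by
  obtain ⟨_, _, _, _, h⟩ := polyTime_iff.1 hf
  exact h

/-- Polynomial time only depends on the codes of the inputs and of the outputs. -/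
theorem PolyTime.recode {f : α → β} (hf : PolyTime ea eb f) {α' β' : Type*} {ea' : α' → Val}
    {eb' : β' → Val} {f' : α' → β'} (u : α' → α) (hu : ∀ a, ea (u a) = ea' a)
    (h : ∀ a, eb (f (u a)) = eb' (f' a)) : PolyTime ea' eb' f' := by
  obtain ⟨p, P, hp⟩ := hf
  refine ⟨p, P, fun a => ?_⟩
  have := hp (u a)
  rwa [hu, h] at this

theorem PolyTime.congr {f : α → β} (hf : PolyTime ea eb f) {g : α → γ}
    (h : ∀ a, eb (f a) = ec (g a)) : PolyTime ea ec g :=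
  hf.recode id (fun _ => rfl) h

theorem PolyTime.id : PolyTime ea ea fun a => a :=
  polyTime_iff.2 ⟨Prog.ident, fun _ => 1, fun _ => Runs.ident _, .const 1, .size⟩

theorem PolyTime.comp {g : β → γ} {f : α → β} (hg : PolyTime eb ec g) (hf : PolyTime ea eb f) :
    PolyTime ea ec fun a => g (f a) := by
  obtain ⟨p, s, hp, hs, hs'⟩ := polyTime_iff.1 hf
  obtain ⟨q, t, hq, ht, ht'⟩ := polyTime_iff.1 hg
  exact polyTime_iff.2 ⟨Prog.seq p q, fun a => s a + t (f a) + 1,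
    fun a => Runs.seq (hp a) (hq (f a)), (hs.add (ht.comp hs')).add (.const 1), ht'.comp hs'⟩

theorem PolyTime.pair {f : α → β} {g : α → γ} (hf : PolyTime ea eb f) (hg : PolyTime ea ec g) :
    PolyTime ea (encodePair eb ec) fun a => (f a, g a) := by
  obtain ⟨p, s, hp, hs, hs'⟩ := polyTime_iff.1 hf
  obtain ⟨q, t, hq, ht, ht'⟩ := polyTime_iff.1 hg
  exact polyTime_iff.2 ⟨Prog.pair p q, fun a => s a + t a + 1,
    fun a => Runs.pair (hp a) (hq a), (hs.add ht).add (.const 1), (hs'.add ht').add (.const 1)⟩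

theorem PolyTime.fst : PolyTime (encodePair ea eb) ea Prod.fst :=
  polyTime_iff.2 ⟨Prog.hd, fun _ => 1, fun _ => Runs.hd _, .const 1,
    PolyBounded.size.mono fun a => by simp only [encodePair, Val.size]; omega⟩

theorem PolyTime.snd : PolyTime (encodePair ea eb) eb Prod.snd :=
  polyTime_iff.2 ⟨Prog.tl, fun _ => 1, fun _ => Runs.tl _, .const 1,
    PolyBounded.size.mono fun a => by simp only [encodePair, Val.size]; omega⟩

theorem exists_runs_const (v : Val) : ∃ p t, ∀ x, Runs p x v t := by
  induction v with
  | nil => exact ⟨Prog.nil, 1, Runs.nil⟩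
  | cons a b iha ihb =>
    obtain ⟨p, s, hp⟩ := iha
    obtain ⟨q, t, hq⟩ := ihb
    exact ⟨Prog.pair p q, s + t + 1, fun x => Runs.pair (hp x) (hq x)⟩

theorem PolyTime.const (b : β) : PolyTime ea eb fun _ => b := by
  obtain ⟨p, t, hp⟩ := exists_runs_const (eb b)
  exact polyTime_iff.2 ⟨p, fun _ => t, fun _ => hp _, .const t, .const _⟩

theorem PolyTime.ite {c : α → Bool} {f g : α → β} (hc : PolyTime ea encodeBit c)
    (hf : PolyTime ea eb f) (hg : PolyTime ea eb g) :
    PolyTime ea eb fun a => if c a then f a else g a := by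
  obtain ⟨r, u, hr, hu, -⟩ := polyTime_iff.1 hc
  obtain ⟨p, s, hp, hs, hs'⟩ := polyTime_iff.1 hf
  obtain ⟨q, t, hq, ht, ht'⟩ := polyTime_iff.1 hg
  refine polyTime_iff.2 ⟨Prog.cond r p q, fun a => u a + (if c a then s a else t a) + 1,
    fun a => ?_, ((hu.add (hs.add ht)).add (.const 1)).mono fun a => ?_,
    (hs'.add ht').mono fun a => ?_⟩
  · have h := hr a
    beta_reduce
    generalize c a = b at h
    cases b with
    | true => exact Runs.cond_cons h (hp a)
    | false => exact Runs.cond_nil h (hq a)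
  · cases c a <;> grind
  · cases c a <;> grind

theorem PolyTime.not {c : α → Bool} (hc : PolyTime ea encodeBit c) :
    PolyTime ea encodeBit fun a => !c a :=
  (hc.ite (.const false) (.const true)).congr fun a => by cases c a <;> rfl

theorem PolyTime.and {b c : α → Bool} (hb : PolyTime ea encodeBit b)
    (hc : PolyTime ea encodeBit c) : PolyTime ea encodeBit fun a => b a && c a :=
  (hb.ite hc (.const false)).congr fun a => by cases b a <;> rfl

theorem PolyTime.or {b c : α → Bool} (hb : PolyTime ea encodeBit b)
    (hc : PolyTime ea encodeBit c) : PolyTime ea encodeBit fun a => b a || c a :=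
  (hb.ite (.const true) hc).congr fun a => by cases b a <;> rfl

end Basic

/-! ### Lists -/

section Lists

variable {α β γ σ : Type*} {ea : α → Val} {eb : β → Val} {ec : γ → Val} {es : σ → Val}

theorem encodeList_map {e : γ → Val} (f : β → γ) (l : List β) :
    encodeList e (l.map f) = encodeList (fun b => e (f b)) l := by
  induction l with
  | nil => rfl
  | cons b l ih => simp [encodeList, ih]

theorem encodeNat_eq (n : ℕ) : encodeNat n = encodeList encodeBit (List.replicate n false) := by
  induction n with
  | zero => rfl
  | succ n ih =>
    rw [encodeNat] at ih
    rw [encodeNat, List.replicate_succ, List.replicate_succ, encodeList, encodeList, ih]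
    rfl

theorem size_encodeNat (n : ℕ) : (encodeNat n).size = 2 * n + 1 := by
  rw [encodeNat_eq]
  induction n with
  | zero => rfl
  | succ n ih => rw [List.replicate_succ, encodeList, Val.size, ih, encodeBit, Val.size]; ring

theorem length_le_size_encodeList (l : List β) : l.length ≤ (encodeList eb l).size := by
  induction l with
  | nil => simp
  | cons b l ih => simp only [encodeList, Val.size, List.length_cons]; omega

theorem size_le_size_encodeList {l : List β} {b : β} (h : b ∈ l) :
    (eb b).size ≤ (encodeList eb l).size := by
  induction l with
  | nil => simp at h
  | cons c l ih =>
    simp only [encodeList, Val.size]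
    rcases List.mem_cons.1 h with rfl | h
    · omega
    · have := ih h; omega

theorem size_encodeList_le {l : List β} {B : ℕ} (h : ∀ b ∈ l, (eb b).size ≤ B) :
    (encodeList eb l).size ≤ l.length * (B + 1) + 1 := by
  induction l with
  | nil => simp [encodeList, Val.size]
  | cons c l ih =>
    have h1 := h c (by simp)
    have h2 := ih fun b hb => h b (by simp [hb])
    simp only [encodeList, Val.size, List.length_cons]
    rw [add_mul]; omega

theorem size_encodeList_append (l l' : List β) :
    (encodeList eb (l ++ l')).size + 1 = (encodeList eb l).size + (encodeList eb l').size := by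
  induction l with
  | nil => simp [encodeList, Val.size]; omega
  | cons c l ih => simp only [List.cons_append, encodeList, Val.size]; omega

theorem size_encodeList_reverse (l : List β) :
    (encodeList eb l.reverse).size = (encodeList eb l).size := by
  induction l with
  | nil => rfl
  | cons c l ih =>
    have := size_encodeList_append (eb := eb) l.reverse [c]
    rw [List.reverse_cons]
    simp only [encodeList, Val.size] at *
    omega

theorem PolyTime.cons {f : α → β} {l : α → List β} (hf : PolyTime ea eb f)
    (hl : PolyTime ea (encodeList eb) l) : PolyTime ea (encodeList eb) fun a => f a :: l a :=
  (hf.pair hl).congr fun _ => rfl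

theorem PolyTime.succ {k : α → ℕ} (hk : PolyTime ea encodeNat k) :
    PolyTime ea encodeNat fun a => k a + 1 :=
  ((PolyTime.const (eb := fun _ : Unit => Val.nil) ()).pair hk).congr fun a => by
    simp [encodePair, encodeNat, List.replicate_succ, encodeList]

theorem PolyTime.tail {l : α → List β} (hl : PolyTime ea (encodeList eb) l) :
    PolyTime ea (encodeList eb) fun a => (l a).tail := by
  obtain ⟨p, t, hp, ht, ht'⟩ := polyTime_iff.1 hl
  have h : ∀ l : List β, (encodeList eb l).tl = encodeList eb l.tail := fun l => by
    cases l <;> rfl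
  refine polyTime_iff.2 ⟨Prog.seq p Prog.tl, fun a => t a + 1 + 1,
    fun a => h (l a) ▸ Runs.seq (hp a) (Runs.tl _), (ht.add (.const 1)).add (.const 1),
    ht'.mono fun a => ?_⟩
  cases l a with
  | nil => exact le_rfl
  | cons b l => simp only [List.tail_cons, encodeList, Val.size]; omega

theorem PolyTime.headD_false {l : α → List Bool} (hl : PolyTime ea (encodeList encodeBit) l) :
    PolyTime ea encodeBit fun a => (l a).headD false := by
  obtain ⟨p, t, hp, ht, ht'⟩ := polyTime_iff.1 hl
  have h : ∀ l : List Bool, (encodeList encodeBit l).hd = encodeBit (l.headD false) := fun l => by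
    cases l <;> rfl
  refine polyTime_iff.2 ⟨Prog.seq p Prog.hd, fun a => t a + 1 + 1,
    fun a => h (l a) ▸ Runs.seq (hp a) (Runs.hd _), (ht.add (.const 1)).add (.const 1),
    (PolyBounded.const 3).mono fun a => ?_⟩
  cases (l a).headD false <;> simp [encodeBit, Val.size]

theorem PolyTime.isEmpty {l : α → List β} (hl : PolyTime ea (encodeList eb) l) :
    PolyTime ea encodeBit fun a => (l a).isEmpty := by
  obtain ⟨p, t, hp, ht, -⟩ := polyTime_iff.1 hl
  obtain ⟨q, s, hq⟩ := exists_runs_const (encodeBit true)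
  refine polyTime_iff.2 ⟨Prog.cond p Prog.nil q,
    fun a => t a + (if (l a).isEmpty then s else 1) + 1, fun a => ?_,
    ((ht.add (.const (s + 1))).add (.const 1)).mono fun a => ?_,
    (PolyBounded.const 3).mono fun a => ?_⟩
  · have h := hp a
    beta_reduce
    generalize l a = l' at h ⊢
    cases l' with
    | nil => exact Runs.cond_nil h (hq _)
    | cons b l' => exact Runs.cond_cons h (Runs.nil _)
  · cases (l a).isEmpty <;> grind
  · cases (l a).isEmpty <;> simp [encodeBit, Val.size]

/-- A loop over a list runs in polynomial time if one pass does and if the state has polynomial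
size throughout. -/
theorem PolyTime.foldl {step : α → σ → β → σ} {init : α → σ} {l : α → List β}
    (hstep : PolyTime (encodePair ea (encodePair eb es)) es fun x => step x.1 x.2.2 x.2.1)
    (hinit : PolyTime ea es init) (hl : PolyTime ea (encodeList eb) l)
    {B : α → ℕ} (hB : PolyBounded ea B)
    (hsize : ∀ a l₁ l₂, l a = l₁ ++ l₂ → (es (l₁.foldl (step a) (init a))).size ≤ B a) :
    PolyTime ea es fun a => (l a).foldl (step a) (init a) := by
  obtain ⟨p, ts, hp, ⟨Q, hQ⟩, -⟩ := polyTime_iff.1 hstep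
  obtain ⟨pi, ti, hpi, hti, hti'⟩ := polyTime_iff.1 hinit
  obtain ⟨pl, tl, hpl, htl, htl'⟩ := polyTime_iff.1 hl
  -- the value of the loop variable is the cell of the input, the remaining list and the state
  let body : Prog := Prog.pair Prog.hd (Prog.pair (Prog.seq Prog.tl (Prog.seq Prog.hd Prog.tl))
    (Prog.seq (Prog.pair Prog.hd (Prog.pair (Prog.seq Prog.tl (Prog.seq Prog.hd Prog.hd))
      (Prog.seq Prog.tl Prog.tl))) p))
  let test : Prog := Prog.seq Prog.tl Prog.hd
  let C : α → ℕ := fun a =>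
    Q.eval ((ea a).size + ((encodeList eb (l a)).size + B a + 1) + 1) + 40
  have key : ∀ a l₂ l₁, l a = l₁ ++ l₂ → ∃ t ≤ l₂.length * C a + 4,
      Runs (Prog.loop test body)
        (Val.cons (ea a) (Val.cons (encodeList eb l₂) (es (l₁.foldl (step a) (init a)))))
        (Val.cons (ea a) (Val.cons Val.nil (es ((l a).foldl (step a) (init a))))) t := by
    intro a l₂
    induction l₂ with
    | nil =>
      intro l₁ h
      rw [List.append_nil] at h
      subst h
      exact ⟨4, by simp, Runs.loop_nil (Runs.seq (Runs.tl _) (Runs.hd _))⟩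
    | cons b l₂ ih =>
      intro l₁ h
      obtain ⟨t, ht, hrun⟩ := ih (l₁ ++ [b]) (by simp [h])
      rw [List.foldl_append, List.foldl_cons, List.foldl_nil] at hrun
      have hpass := hp (a, b, l₁.foldl (step a) (init a))
      have htime : ts (a, b, l₁.foldl (step a) (init a)) + 40 ≤ C a := by
        refine Nat.add_le_add_right ((hQ _).trans (eval_nat_mono Q ?_)) 40
        have h1 : (eb b).size ≤ (encodeList eb (l a)).size :=
          size_le_size_encodeList (by simp [h])
        have h2 := hsize a l₁ (b :: l₂) h
        simp only [encodePair, Val.size]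
        omega
      refine ⟨_, ?_, Runs.loop_cons (Runs.seq (Runs.tl _) (Runs.hd _))
        (Runs.pair (Runs.hd _) (Runs.pair (Runs.seq (Runs.tl _) (Runs.seq (Runs.hd _) (Runs.tl _)))
          (Runs.seq (Runs.pair (Runs.hd _) (Runs.pair
            (Runs.seq (Runs.tl _) (Runs.seq (Runs.hd _) (Runs.hd _)))
            (Runs.seq (Runs.tl _) (Runs.tl _)))) hpass))) hrun⟩
      rw [List.length_cons, add_mul]
      omega
  choose t ht hrun using fun a => key a (l a) [] rfl
  refine polyTime_iff.2 ⟨Prog.seq (Prog.pair Prog.ident (Prog.pair pl pi))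
    (Prog.seq (Prog.loop test body) (Prog.seq Prog.tl Prog.tl)), fun a => _,
    fun a => Runs.seq (Runs.pair (Runs.ident _) (Runs.pair (hpl a) (hpi a)))
      (Runs.seq (hrun a) (Runs.seq (Runs.tl _) (Runs.tl _))), ?_,
    hB.mono fun a => hsize a (l a) [] (by simp)⟩
  have hC : PolyBounded ea C := (PolyBounded.eval Q
    ((PolyBounded.size.add ((htl'.add hB).add (.const 1))).add (.const 1))).add (.const 40)
  have ht' : PolyBounded ea t := ((htl'.mul hC).add (.const 4)).mono fun a => (ht a).trans
    (Nat.add_le_add_right (Nat.mul_le_mul_right _ (length_le_size_encodeList _)) _)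
  exact ((((PolyBounded.const 1).add ((htl.add hti).add (.const 1))).add (.const 1)).add
    ((ht'.add (.const (1 + 1 + 1))).add (.const 1))).add (.const 1)

theorem PolyTime.reverse {l : α → List β} (hl : PolyTime ea (encodeList eb) l) :
    PolyTime ea (encodeList eb) fun a => (l a).reverse := by
  have h : ∀ l s : List β, l.foldl (fun s b => b :: s) s = l.reverse ++ s := by
    intro l
    induction l with
    | nil => simp
    | cons b l ih => intro s; simp [ih]
  refine (PolyTime.foldl (step := fun _ s b => b :: s) (init := fun _ => []) (l := l)
    (es := encodeList eb) (PolyTime.cons (PolyTime.fst.comp .snd) (PolyTime.snd.comp .snd))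
    (.const []) hl hl.size_le ?_).congr fun a => by rw [h, List.append_nil]
  intro a l₁ l₂ h'
  have := size_encodeList_append (eb := eb) l₁ l₂
  rw [h, List.append_nil, size_encodeList_reverse, h']
  have h3 : 1 ≤ (encodeList eb l₂).size := by cases l₂ <;> simp [encodeList, Val.size]
  omega

/-- Recursion along a list takes polynomial time if one step does and if the values at all
suffixes have polynomial size. -/
theorem PolyTime.foldr {step : α → β → σ → σ} {init : α → σ} {l : α → List β}
    (hstep : PolyTime (encodePair ea (encodePair eb es)) es fun x => step x.1 x.2.1 x.2.2)
    (hinit : PolyTime ea es init) (hl : PolyTime ea (encodeList eb) l)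
    {B : α → ℕ} (hB : PolyBounded ea B)
    (hsize : ∀ a l₁ l₂, l a = l₁ ++ l₂ → (es (l₂.foldr (step a) (init a))).size ≤ B a) :
    PolyTime ea es fun a => (l a).foldr (step a) (init a) := by
  refine (PolyTime.foldl (step := fun a s b => step a b s) hstep hinit hl.reverse hB ?_).congr
    fun a => by rw [List.foldl_reverse]
  intro a l₁ l₂ h
  have := hsize a l₂.reverse l₁.reverse (by rw [← List.reverse_append, ← h, List.reverse_reverse])
  rwa [List.foldr_reverse] at this

end Lists

section ListFunctions

variable {α β γ : Type*} {ea : α → Val} {eb : β → Val} {ec : γ → Val}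

/-- A quantity bounded in terms of the context and of an entry has a bound that is uniform over the
entries of a list computed from the context. -/
theorem PolyBounded.exists_forall_mem {u : α × β → ℕ} (hu : PolyBounded (encodePair ea eb) u)
    {l : α → List β} (hl : PolyTime ea (encodeList eb) l) :
    ∃ B : α → ℕ, PolyBounded ea B ∧ ∀ a, ∀ b ∈ l a, u (a, b) ≤ B a := by
  obtain ⟨P, hP⟩ := hu
  refine ⟨fun a => P.eval ((ea a).size + (encodeList eb (l a)).size + 1),
    PolyBounded.eval P ((PolyBounded.size.add hl.size_le).add (.const 1)),
    fun a b hb => (hP (a, b)).trans (eval_nat_mono P ?_)⟩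
  have := size_le_size_encodeList (eb := eb) hb
  simp only [encodePair, Val.size]
  omega

theorem size_encodeList_le_of_sublist {l l' : List β} (h : l'.Sublist l) :
    (encodeList eb l').size ≤ (encodeList eb l).size := by
  induction h with
  | slnil => exact le_rfl
  | cons a _ ih => simp only [encodeList, Val.size]; omega
  | cons_cons a _ ih => simp only [encodeList, Val.size]; omega

theorem size_encodeBit_le (b : Bool) : (encodeBit b).size ≤ 3 := by
  cases b <;> simp [encodeBit, Val.size]

theorem PolyTime.map {F : α → β → γ} (hF : PolyTime (encodePair ea eb) ec fun x => F x.1 x.2)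
    {l : α → List β} (hl : PolyTime ea (encodeList eb) l) :
    PolyTime ea (encodeList ec) fun a => (l a).map (F a) := by
  obtain ⟨B, hB, hB'⟩ := hF.size_le.exists_forall_mem hl
  have h : ∀ a (l : List β), l.foldr (fun b s => F a b :: s) [] = l.map (F a) := fun a l => by
    induction l with
    | nil => rfl
    | cons b l ih => simp [ih]
  refine (PolyTime.foldr (step := fun a b s => F a b :: s) (init := fun _ => [])
    (es := encodeList ec)
    ((hF.comp (PolyTime.fst.pair (PolyTime.fst.comp .snd))).cons (PolyTime.snd.comp .snd))
    (.const []) hl ((hl.size_le.mul (hB.add (.const 1))).add (.const 1)) ?_).congr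
    fun a => by rw [h]
  intro a l₁ l₂ hl'
  rw [h]
  refine (size_encodeList_le (B := B a) ?_).trans
    (Nat.add_le_add_right (Nat.mul_le_mul_right _ ?_) 1)
  · simp only [List.mem_map, forall_exists_index, and_imp, forall_apply_eq_imp_iff₂]
    exact fun b hb => hB' a b (by simp [hl', hb])
  · have := length_le_size_encodeList (eb := eb) (l a)
    rw [List.length_map]
    rw [hl', List.length_append, ← hl'] at this
    omega

theorem PolyTime.filter {p : α → β → Bool}
    (hp : PolyTime (encodePair ea eb) encodeBit fun x => p x.1 x.2)
    {l : α → List β} (hl : PolyTime ea (encodeList eb) l) :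
    PolyTime ea (encodeList eb) fun a => (l a).filter (p a) := by
  have h : ∀ a (l : List β),
      l.foldr (fun b s => if p a b then b :: s else s) [] = l.filter (p a) := fun a l => by
    induction l with
    | nil => rfl
    | cons b l ih => simp [ih, List.filter_cons]
  refine (PolyTime.foldr (step := fun a b s => if p a b then b :: s else s)
    (init := fun _ => []) (es := encodeList eb)
    ((hp.comp (PolyTime.fst.pair (PolyTime.fst.comp .snd))).ite
      (PolyTime.cons (PolyTime.fst.comp .snd) (PolyTime.snd.comp .snd)) (PolyTime.snd.comp .snd))
    (.const []) hl hl.size_le ?_).congr fun a => by rw [h]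
  intro a l₁ l₂ hl'
  rw [h, hl']
  exact size_encodeList_le_of_sublist
    (List.filter_sublist.trans (List.sublist_append_right l₁ l₂))

theorem PolyTime.any {p : α → β → Bool}
    (hp : PolyTime (encodePair ea eb) encodeBit fun x => p x.1 x.2)
    {l : α → List β} (hl : PolyTime ea (encodeList eb) l) :
    PolyTime ea encodeBit fun a => (l a).any (p a) :=
  (PolyTime.foldr (step := fun a b s => p a b || s) (init := fun _ => false) (es := encodeBit)
    ((hp.comp (PolyTime.fst.pair (PolyTime.fst.comp .snd))).or (PolyTime.snd.comp .snd))
    (.const false) hl (.const 3) fun _ _ _ _ => size_encodeBit_le _).congr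
    fun a => by
      congr 1
      induction l a with
      | nil => rfl
      | cons b l ih => rw [List.foldr_cons, ih, List.any_cons]

theorem PolyTime.all {p : α → β → Bool}
    (hp : PolyTime (encodePair ea eb) encodeBit fun x => p x.1 x.2)
    {l : α → List β} (hl : PolyTime ea (encodeList eb) l) :
    PolyTime ea encodeBit fun a => (l a).all (p a) :=
  (PolyTime.any (p := fun a b => !p a b) hp.not hl).not.congr
    fun a => by rw [List.all_eq_not_any_not]

theorem PolyTime.append {l l' : α → List β} (hl : PolyTime ea (encodeList eb) l)
    (hl' : PolyTime ea (encodeList eb) l') :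
    PolyTime ea (encodeList eb) fun a => l a ++ l' a := by
  refine (PolyTime.foldr (step := fun _ b s => b :: s) (init := l') (es := encodeList eb)
    (PolyTime.cons (PolyTime.fst.comp .snd) (PolyTime.snd.comp .snd))
    hl' hl (hl.size_le.add hl'.size_le) ?_).congr fun a => by rw [List.foldr_cons_eq_append']
  intro a l₁ l₂ h
  have h1 := size_encodeList_append (eb := eb) l₂ (l' a)
  have h2 := size_encodeList_le_of_sublist (eb := eb) (List.sublist_append_right l₁ l₂)
  rw [← h] at h2
  rw [List.foldr_cons_eq_append']
  omega

theorem size_encodeList_flatten_le (ls : List (List β)) :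
    (encodeList eb ls.flatten).size ≤ (encodeList (encodeList eb) ls).size := by
  induction ls with
  | nil => exact le_rfl
  | cons l ls ih =>
    have := size_encodeList_append (eb := eb) l ls.flatten
    simp only [List.flatten_cons, encodeList, Val.size]
    omega

theorem PolyTime.flatten {ls : α → List (List β)}
    (hls : PolyTime ea (encodeList (encodeList eb)) ls) :
    PolyTime ea (encodeList eb) fun a => (ls a).flatten := by
  have h : ∀ ls : List (List β), ls.foldr (fun l s => l ++ s) [] = ls.flatten := fun ls => by
    induction ls with
    | nil => rfl
    | cons l ls ih => simp [ih]
  refine (PolyTime.foldr (step := fun _ l s => l ++ s) (init := fun _ => [])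
    (es := encodeList eb) ((PolyTime.fst.comp .snd).append (PolyTime.snd.comp .snd))
    (.const []) hls hls.size_le ?_).congr fun a => by rw [h]
  intro a l₁ l₂ h'
  rw [h, h']
  exact (size_encodeList_flatten_le l₂).trans
    (size_encodeList_le_of_sublist (List.sublist_append_right l₁ l₂))

theorem PolyTime.flatMap {F : α → β → List γ}
    (hF : PolyTime (encodePair ea eb) (encodeList ec) fun x => F x.1 x.2)
    {l : α → List β} (hl : PolyTime ea (encodeList eb) l) :
    PolyTime ea (encodeList ec) fun a => (l a).flatMap (F a) :=
  (hF.map hl).flatten.congr fun a => by rw [List.flatMap_def]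

theorem PolyTime.findIdx {p : α → β → Bool}
    (hp : PolyTime (encodePair ea eb) encodeBit fun x => p x.1 x.2)
    {l : α → List β} (hl : PolyTime ea (encodeList eb) l) :
    PolyTime ea encodeNat fun a => (l a).findIdx (p a) := by
  have h : ∀ a (l : List β),
      l.foldr (fun b s => if p a b then 0 else s + 1) 0 = l.findIdx (p a) := fun a l => by
    induction l with
    | nil => rfl
    | cons b l ih => rw [List.findIdx_cons, List.foldr_cons, ih]; cases p a b <;> rfl
  refine (PolyTime.foldr (step := fun a b s => if p a b then 0 else s + 1)
    (init := fun _ => 0) (es := encodeNat)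
    ((hp.comp (PolyTime.fst.pair (PolyTime.fst.comp .snd))).ite (.const 0)
      (PolyTime.succ (PolyTime.snd.comp .snd)))
    (.const 0) hl (((PolyBounded.const 2).mul hl.size_le).add (.const 1)) ?_).congr
    fun a => by rw [h]
  intro a l₁ l₂ hl'
  have h1 := length_le_size_encodeList (eb := eb) (l a)
  have h2 : l₂.findIdx (p a) ≤ l₂.length := List.findIdx_le_length
  rw [hl', List.length_append, ← hl'] at h1
  rw [h, size_encodeNat]
  omega

theorem PolyTime.zipIdx {l : α → List β} (hl : PolyTime ea (encodeList eb) l) :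
    PolyTime ea (encodeList (encodePair eb encodeNat)) fun a => (l a).zipIdx := by
  -- the state is the next index and the reversed list of the entries passed so far
  have h : ∀ (l : List β) k s,
      l.foldl (fun (s : ℕ × List (β × ℕ)) b => (s.1 + 1, (b, s.1) :: s.2)) (k, s) =
        (k + l.length, (l.zipIdx k).reverse ++ s) := by
    intro l
    induction l with
    | nil => simp
    | cons b l ih => intro k s; simp [ih, List.zipIdx_cons]; omega
  have hs : PolyBounded ea fun a => (encodeList eb (l a)).size := hl.size_le
  refine ((PolyTime.snd.comp (PolyTime.foldl
    (step := fun _ (s : ℕ × List (β × ℕ)) b => (s.1 + 1, (b, s.1) :: s.2))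
    (init := fun _ => (0, [])) (es := encodePair encodeNat (encodeList (encodePair eb encodeNat)))
    ((PolyTime.succ (PolyTime.fst.comp (PolyTime.snd.comp .snd))).pair
      (((PolyTime.fst.comp .snd).pair (PolyTime.fst.comp (PolyTime.snd.comp .snd))).cons
        (PolyTime.snd.comp (PolyTime.snd.comp .snd))))
    (.const (0, [])) hl
    (((PolyBounded.const 2).mul hs).add ((hs.mul (((PolyBounded.const 3).mul hs).add
      (.const 3))).add (.const 3))) ?_)).reverse).congr fun a => by simp [h]
  intro a l₁ l₂ hl'
  have h1 := length_le_size_encodeList (eb := eb) (l a)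
  rw [hl', List.length_append, ← hl'] at h1
  have h2 : (encodeList (encodePair eb encodeNat) l₁.zipIdx.reverse).size ≤
      l₁.zipIdx.reverse.length * (3 * (encodeList eb (l a)).size + 2 + 1) + 1 := by
    refine size_encodeList_le fun x hx => ?_
    have hx' := List.mem_zipIdx (List.mem_reverse.1 hx)
    have h3 : (eb x.1).size ≤ (encodeList eb (l a)).size :=
      size_le_size_encodeList (by rw [hx'.2.2, hl']; simp)
    simp only [encodePair, Val.size, size_encodeNat]
    omega
  rw [List.length_reverse, List.length_zipIdx] at h2
  have h4 : l₁.length * (3 * (encodeList eb (l a)).size + 2 + 1) ≤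
      (encodeList eb (l a)).size * (3 * (encodeList eb (l a)).size + 3) :=
    Nat.mul_le_mul_right _ (by omega)
  simp only [h, List.append_nil, encodePair, Val.size, size_encodeNat, zero_add]
  omega

/-! ### Equality tests -/

theorem PolyTime.eq_listBool {x y : α → List Bool} (hx : PolyTime ea (encodeList encodeBit) x)
    (hy : PolyTime ea (encodeList encodeBit) y) :
    PolyTime ea encodeBit fun a => decide (x a = y a) := by
  let step : Bool × List Bool → Bool → Bool × List Bool := fun s b =>
    (s.1 && (!s.2.isEmpty && (if b then s.2.headD false else !s.2.headD false)), s.2.tail)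
  have h : ∀ (x y : List Bool) (c : Bool), (c && decide (x = y)) =
      ((x.foldl step (c, y)).1 && (x.foldl step (c, y)).2.isEmpty) := by
    intro x
    induction x with
    | nil => intro y c; cases y <;> simp
    | cons b x ih =>
      intro y c
      rw [List.foldl_cons, ← ih]
      cases y with
      | nil => simp
      | cons b' y => cases c <;> cases b <;> cases b' <;> rw [Bool.eq_iff_iff] <;> simp <;>
          exact decide_eq_true_iff.symm
  have h' : ∀ (x : List Bool) s, (x.foldl step s).2.Sublist s.2 := by
    intro x
    induction x with
    | nil => simp
    | cons b x ih => exact fun s => (ih (step s b)).trans (List.tail_sublist s.2)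
  have hs : PolyTime (encodePair ea (encodePair encodeBit
      (encodePair encodeBit (encodeList encodeBit)))) (encodePair encodeBit (encodeList encodeBit))
      fun x => step x.2.2 x.2.1 := by
    have h2 := (PolyTime.snd (ea := ea) (eb := encodePair encodeBit
      (encodePair encodeBit (encodeList encodeBit))))
    have h3 := PolyTime.snd.comp (PolyTime.snd.comp h2)
    exact ((PolyTime.fst.comp (PolyTime.snd.comp h2)).and (h3.isEmpty.not.and
      ((PolyTime.fst.comp h2).ite h3.headD_false h3.headD_false.not))).pair h3.tail
  have hf := PolyTime.foldl (step := fun _ => step) (init := fun a => (true, y a)) hs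
    ((PolyTime.const true).pair hy) hx ((PolyBounded.const 4).add hy.size_le) fun a l₁ l₂ _ => by
      have h1 := size_encodeBit_le (l₁.foldl step (true, y a)).1
      have h2 := size_encodeList_le_of_sublist (eb := encodeBit) (h' l₁ (true, y a))
      simp only [encodePair, Val.size]
      dsimp only at h2
      omega
  exact ((PolyTime.fst.comp hf).and (PolyTime.snd.comp hf).isEmpty).congr fun a => by
    rw [← h, Bool.true_and]

theorem PolyTime.eq_nat {k m : α → ℕ} (hk : PolyTime ea encodeNat k)
    (hm : PolyTime ea encodeNat m) : PolyTime ea encodeBit fun a => decide (k a = m a) :=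
  (PolyTime.eq_listBool (x := fun a => List.replicate (k a) false)
    (y := fun a => List.replicate (m a) false) (hk.congr fun _ => encodeNat_eq _)
    (hm.congr fun _ => encodeNat_eq _)).congr fun a => by
      rw [decide_eq_decide.2]
      exact List.replicate_left_inj

theorem PolyTime.eq_elem {F : Type*} [DecidableEq F] {enc : Computability.Encoding F Bool}
    {u v : α → F} (hu : PolyTime ea (encodeElem enc) u) (hv : PolyTime ea (encodeElem enc) v) :
    PolyTime ea encodeBit fun a => decide (u a = v a) :=
  (PolyTime.eq_listBool (x := fun a => enc.encode (u a)) (y := fun a => enc.encode (v a))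
    (hu.congr fun _ => rfl) (hv.congr fun _ => rfl)).congr fun a => by
      rw [decide_eq_decide.2 enc.encode_injective.eq_iff]

/-- Addition of numbers in unary. -/
theorem PolyTime.add_nat {k m : α → ℕ} (hk : PolyTime ea encodeNat k)
    (hm : PolyTime ea encodeNat m) : PolyTime ea encodeNat fun a => k a + m a :=
  (PolyTime.append (l := fun a => List.replicate (k a) false)
    (l' := fun a => List.replicate (m a) false) (hk.congr fun _ => encodeNat_eq _)
    (hm.congr fun _ => encodeNat_eq _)).congr fun a => by
      rw [List.replicate_append_replicate, encodeNat_eq]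

theorem PolyTime.length {l : α → List β} (hl : PolyTime ea (encodeList eb) l) :
    PolyTime ea encodeNat fun a => (l a).length :=
  (PolyTime.map (F := fun _ _ => false) (ec := encodeBit) (.const false) hl).congr fun a => by
    rw [encodeNat_eq, List.map_const']

end ListFunctions

end TreeMachine

/-! ### Linear algebra -/

section LinearAlgebra

variable {F : Type*} [Field F]

/-- A linear map that is injective on a subspace reflects linear dependence inside that
subspace. -/
theorem LinearMap.map_mem_span_image_iff {V V' : Type*} [AddCommGroup V] [Module F V]
    [AddCommGroup V'] [Module F V'] (f : V →ₗ[F] V') {W : Submodule F V}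
    (hW : Disjoint W (LinearMap.ker f)) {x : V} {s : Set V} (hx : x ∈ W) (hs : s ⊆ W) :
    f x ∈ Submodule.span F (f '' s) ↔ x ∈ Submodule.span F s := by
  rw [← Submodule.map_span]
  refine ⟨?_, Submodule.mem_map_of_mem⟩
  rintro ⟨y, hy, hxy⟩
  have hyW : y ∈ W := Submodule.span_le.2 hs hy
  have h0 : y - x = 0 := Submodule.disjoint_def.1 hW _ (W.sub_mem hyW hx) (by simp [hxy])
  rwa [← sub_eq_zero.1 h0]

/-- Linear dependence among functions can be tested after reindexing along a map whose range
contains their supports. -/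
theorem comp_mem_span_image_iff {X Y ι : Type*} (σ : Y → X) (w : ι → X → F)
    (hw : ∀ k, ∀ x ∉ Set.range σ, w k x = 0) (j : ι) (s : Set ι) :
    w j ∘ σ ∈ Submodule.span F ((fun k => w k ∘ σ) '' s) ↔ w j ∈ Submodule.span F (w '' s) := by
  let W : Submodule F (X → F) :=
    { carrier := {v | ∀ x ∉ Set.range σ, v x = 0}
      add_mem' := fun {u v} hu hv x hx => by simp [hu x hx, hv x hx]
      zero_mem' := fun _ _ => rfl
      smul_mem' := fun c v hv x hx => by simp [hv x hx] }
  have hW : Disjoint W (LinearMap.ker (LinearMap.funLeft F F σ)) := by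
    refine Submodule.disjoint_def.2 fun v hv hv' => funext fun x => ?_
    by_cases hx : x ∈ Set.range σ
    · obtain ⟨y, rfl⟩ := hx
      exact congrFun (LinearMap.mem_ker.1 hv') y
    · exact hv x hx
  rw [← LinearMap.map_mem_span_image_iff (LinearMap.funLeft F F σ) hW (hw j)
    (Set.image_subset_iff.2 fun k _ => hw k), Set.image_image]
  rfl

namespace Matrix

/-- In a row echelon form, the pivot columns are the columns that do not depend on the columns to
their left: a column without a pivot is cleared from the bottom to the top by means of the pivots
to its left. -/
theorem IsRowEchelon.exists_isLeadingEntry_iff {m n : ℕ} {R : Matrix (Fin m) (Fin n) F}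
    (hR : R.IsRowEchelon) (q : Fin n) :
    (∃ i, R.IsLeadingEntry i q) ↔ R.col q ∉ Submodule.span F (R.col '' Set.Iio q) := by
  constructor
  · rintro ⟨i, h0, hq⟩ hmem
    have hle : Submodule.span F (R.col '' Set.Iio q) ≤
        LinearMap.ker (LinearMap.proj (R := F) (φ := fun _ : Fin m => F) i) := by
      rw [Submodule.span_le]
      rintro _ ⟨k, hk, rfl⟩
      exact h0 k hk
    exact hq (hle hmem)
  · contrapose!
    intro hno
    have key : ∀ s ≤ m, ∃ v ∈ Submodule.span F (R.col '' Set.Iio q),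
        ∀ i : Fin m, m ≤ i + s → R i q = v i := by
      intro s
      induction s with
      | zero => exact fun _ => ⟨0, Submodule.zero_mem _, fun i hi => by omega⟩
      | succ s ih =>
        intro hs
        obtain ⟨v, hv, hv'⟩ := ih (by omega)
        let r : Fin m := ⟨m - (s + 1), by omega⟩
        by_cases hr : ∀ k < q, R r k = 0
        · refine ⟨v, hv, fun i hi => ?_⟩
          rcases Nat.lt_or_ge (i + s) m with hi' | hi'
          · obtain rfl : i = r := Fin.ext (by simp only [r]; omega)
            have hle : Submodule.span F (R.col '' Set.Iio q) ≤
                LinearMap.ker (LinearMap.proj (R := F) (φ := fun _ : Fin m => F) r) := by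
              rw [Submodule.span_le]
              rintro _ ⟨k, hk, rfl⟩
              exact hr k hk
            have hvr : v r = 0 := hle hv
            rw [hvr]
            by_contra hne
            exact hno r ⟨hr, hne⟩
          · exact hv' i hi'
        · -- the first nonzero entry of the row `r` lies to the left of the column `q`
          push Not at hr
          obtain ⟨k, ⟨hkq, hk⟩, hmin⟩ := WellFounded.has_min wellFounded_lt
            {k : Fin n | k < q ∧ R r k ≠ 0} hr
          have hlead : ∀ k' < k, R r k' = 0 := fun k' hk' => by
            by_contra hne
            exact hmin k' ⟨hk'.trans hkq, hne⟩ hk'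
          refine ⟨v + ((R r q - v r) / R r k) • R.col k, Submodule.add_mem _ hv
            (Submodule.smul_mem _ _ (Submodule.subset_span ⟨k, hkq, rfl⟩)), fun i hi => ?_⟩
          rcases Nat.lt_or_ge (i + s) m with hi' | hi'
          · obtain rfl : i = r := Fin.ext (by simp only [r]; omega)
            simp [hk]
          · have hik : R i k = 0 := hR (i₁ := r) (Fin.lt_def.2 (by simp only [r]; omega)) hlead
            simp [hik, hv' i hi']
    obtain ⟨v, hv, hv'⟩ := key m le_rfl
    rwa [show R.col q = v from funext fun i => hv' i (by omega)]

/-- The pivots of a row echelon form of `A` mark the columns of `A` that do not depend on the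
columns to their left. -/
theorem exists_isLeadingEntry_mul_iff {m n : ℕ} {A : Matrix (Fin m) (Fin n) F}
    {P : Matrix (Fin m) (Fin m) F} (hP : IsUnit P) (hR : (P * A).IsRowEchelon) (q : Fin n) :
    (∃ i, (P * A).IsLeadingEntry i q) ↔ A.col q ∉ Submodule.span F (A.col '' Set.Iio q) := by
  have hker : LinearMap.ker P.mulVecLin = ⊥ :=
    LinearMap.ker_eq_bot.2 (Matrix.mulVec_injective_iff_isUnit.2 hP)
  have hcol : ∀ k, (P * A).col k = P.mulVecLin (A.col k) := fun k => rfl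
  have himage : (P * A).col '' Set.Iio q = P.mulVecLin '' (A.col '' Set.Iio q) := by
    rw [Set.image_image]
    rfl
  rw [hR.exists_isLeadingEntry_iff, himage, hcol, LinearMap.map_mem_span_image_iff P.mulVecLin
    (W := ⊤) (by simp [hker]) Submodule.mem_top (fun _ _ => Submodule.mem_top)]

/-- The matrix with blocks `1`, `D` in the upper and `E`, `0` in the lower rows. Its Schur
complement is `- E * D`, so that its right columns depend on their predecessors exactly as the
columns of `E * D` do, without the product having been computed. -/
def schurBlock {s t m : ℕ} (D : Matrix (Fin t) (Fin m) F) (E : Matrix (Fin s) (Fin t) F) :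
    Matrix (Fin (t + s)) (Fin (t + m)) F :=
  Fin.append (fun u => Fin.append (fun v => if u = v then 1 else 0) (D u))
    (fun u => Fin.append (E u) fun _ => 0)

theorem col_schurBlock_mem_span_iff {s t m : ℕ} (D : Matrix (Fin t) (Fin m) F)
    (E : Matrix (Fin s) (Fin t) F) (j : Fin m) :
    (schurBlock D E).col (Fin.natAdd t j) ∈
        Submodule.span F ((schurBlock D E).col '' Set.Iio (Fin.natAdd t j)) ↔
      (E * D).col j ∈ Submodule.span F ((E * D).col '' Set.Iio j) := by
  obtain ⟨N, hN⟩ : ∃ N, N = schurBlock D E := ⟨_, rfl⟩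
  have h11 : ∀ u v, N (Fin.castAdd s u) (Fin.castAdd m v) = if u = v then 1 else 0 := by
    simp [hN, schurBlock]
  have h12 : ∀ u k, N (Fin.castAdd s u) (Fin.natAdd t k) = D u k := by simp [hN, schurBlock]
  have h21 : ∀ u v, N (Fin.natAdd t u) (Fin.castAdd m v) = E u v := by simp [hN, schurBlock]
  have h22 : ∀ u k, N (Fin.natAdd t u) (Fin.natAdd t k) = 0 := by simp [hN, schurBlock]
  rw [← hN]
  let φ : (Fin (t + s) → F) →ₗ[F] (Fin s → F) :=
    E.mulVecLin ∘ₗ LinearMap.funLeft F F (Fin.castAdd s) - LinearMap.funLeft F F (Fin.natAdd t)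
  have hφ : ∀ x u, φ x u = ∑ v, E u v * x (Fin.castAdd s v) - x (Fin.natAdd t u) :=
    fun x u => rfl
  have hleft : ∀ p, φ (N.col (Fin.castAdd m p)) = 0 := fun p => funext fun u => by
    simp [hφ, h11, h21]
  have hright : ∀ k, φ (N.col (Fin.natAdd t k)) = (E * D).col k := fun k => funext fun u => by
    simp [hφ, h12, h22, Matrix.mul_apply]
  have hker : LinearMap.ker φ ≤ Submodule.span F (N.col '' Set.Iio (Fin.natAdd t j)) := by
    intro x hx
    have hx' : x = ∑ p, x (Fin.castAdd s p) • N.col (Fin.castAdd m p) := by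
      funext i
      rw [Finset.sum_apply]
      refine Fin.addCases (fun u => ?_) (fun u => ?_) i
      · simp [h11]
      · have := congrFun (LinearMap.mem_ker.1 hx) u
        rw [hφ, Pi.zero_apply, sub_eq_zero] at this
        rw [← this]
        simp [h21, mul_comm]
    rw [hx']
    exact Submodule.sum_mem _ fun p _ => Submodule.smul_mem _ _ (Submodule.subset_span
      ⟨_, Fin.lt_def.2 (by simp only [Fin.val_castAdd, Fin.val_natAdd]; omega), rfl⟩)
  rw [← hright, show (E * D).col '' Set.Iio j = φ '' (N.col '' (Fin.natAdd t '' Set.Iio j)) by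
    simp only [Set.image_image, hright], ← Submodule.map_span]
  constructor
  · intro h
    refine (Submodule.map_span_le _ _ _).2 ?_ (Submodule.mem_map_of_mem (f := φ) h)
    rintro _ ⟨q, hq, rfl⟩
    revert hq
    refine Fin.addCases (fun p _ => ?_) (fun k hk => ?_) q
    · rw [hleft]
      exact Submodule.zero_mem _
    · have hk' := Fin.lt_def.1 (Set.mem_Iio.1 hk)
      simp only [Fin.val_natAdd] at hk'
      exact Submodule.mem_map_of_mem (Submodule.subset_span
        ⟨_, ⟨k, Fin.lt_def.2 (by omega), rfl⟩, rfl⟩)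
  · rintro ⟨y, hy, hxy⟩
    have hy' : y ∈ Submodule.span F (N.col '' Set.Iio (Fin.natAdd t j)) := by
      refine Submodule.span_mono (Set.image_mono ?_) hy
      rintro _ ⟨k, hk, rfl⟩
      have hk' := Fin.lt_def.1 (Set.mem_Iio.1 hk)
      exact Fin.lt_def.2 (by simp only [Fin.val_natAdd]; omega)
    have := hker (x := N.col (Fin.natAdd t j) - y) (by simp [hxy])
    simpa using Submodule.add_mem _ this hy'

end Matrix

end LinearAlgebra

/-! ### Greedy bases -/

section Greedy

variable {F V β : Type*} [Field F] [AddCommGroup V] [Module F V]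

open Classical in
/-- The entries of the list `L` whose vectors do not depend on the vectors of the entries before
them. -/
noncomputable def List.greedyBasis (F : Type*) [Field F] [Module F V] (v : β → V) (L : List β) :
    List β :=
  (L.zipIdx.filter fun x => decide
    (v x.1 ∉ Submodule.span F (Set.range fun i : Fin (L.take x.2).length =>
      v ((L.take x.2).get i)))).map Prod.fst

theorem List.greedyBasis_sublist (v : β → V) (L : List β) :
    (L.greedyBasis F v).Sublist L := by
  unfold List.greedyBasis
  conv_rhs => rw [← List.zipIdx_map_fst 0 L]
  exact List.filter_sublist.map _

open Classical in
theorem List.greedyBasis_concat (v : β → V) (L : List β) (b : β) :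
    (L ++ [b]).greedyBasis F v = L.greedyBasis F v ++
      if v b ∈ Submodule.span F (Set.range fun i : Fin L.length => v (L.get i)) then [] else [b] := by
  have h1 : ∀ x ∈ L.zipIdx, (L ++ [b]).take x.2 = L.take x.2 := fun x hx => by
    have := List.mem_zipIdx hx
    exact List.take_append_of_le_length (by omega)
  have h2 : (L ++ [b]).take L.length = L := by simp
  unfold List.greedyBasis
  rw [List.zipIdx_append, List.filter_append, List.map_append, List.filter_congr (q := fun x =>
    decide (v x.1 ∉ Submodule.span F (Set.range fun i : Fin (L.take x.2).length =>
      v ((L.take x.2).get i)))) fun x hx => by rw [h1 x hx]]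
  congr 1
  simp only [List.zipIdx_singleton, List.filter_cons, List.filter_nil, zero_add]
  rw [h2]
  split <;> simp_all

theorem List.span_concat (v : β → V) (L : List β) (b : β) :
    Submodule.span F (Set.range fun i : Fin (L ++ [b]).length => v ((L ++ [b]).get i)) =
      Submodule.span F (Set.range fun i : Fin L.length => v (L.get i)) ⊔ Submodule.span F {v b} := by
  have h : ∀ L : List β, (Set.range fun i : Fin L.length => v (L.get i)) = v '' {b | b ∈ L} :=
    fun L => by
      rw [← Set.range_list_get, ← Set.range_comp]
      rfl
  rw [h, h, ← Submodule.span_union]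
  congr 1
  ext x
  simp [or_comm, eq_comm, or_and_right, exists_or]

theorem List.greedyBasis_spec (v : β → V) (L : List β) :
    LinearIndependent F (fun i : Fin (L.greedyBasis F v).length => v ((L.greedyBasis F v).get i)) ∧
      Submodule.span F (Set.range fun i : Fin (L.greedyBasis F v).length =>
        v ((L.greedyBasis F v).get i)) =
      Submodule.span F (Set.range fun i : Fin L.length => v (L.get i)) := by
  induction L using List.reverseRecOn with
  | nil =>
    have : IsEmpty (Fin (List.greedyBasis F v []).length) := Fin.isEmpty
    exact ⟨linearIndependent_empty_type, rfl⟩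
  | append_singleton L b ih =>
    obtain ⟨hli, hspan⟩ := ih
    have hconcat := List.greedyBasis_concat (F := F) v L b
    by_cases hb : v b ∈ Submodule.span F (Set.range fun i : Fin L.length => v (L.get i))
    · rw [if_pos hb, List.append_nil] at hconcat
      rw [hconcat]
      refine ⟨hli, ?_⟩
      rw [List.span_concat, hspan, sup_eq_left.2]
      simpa using hb
    · rw [if_neg hb] at hconcat
      rw [hconcat]
      refine ⟨?_, by rw [List.span_concat, List.span_concat, hspan]⟩
      generalize L.greedyBasis F v = L' at hli hspan
      rw [← hspan] at hb
      have h := linearIndependent_finSnoc.2 ⟨hli, hb⟩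
      rw [← linearIndependent_equiv
        (finCongr (show (L' ++ [b]).length = L'.length + 1 by simp))] at h
      convert h using 1
      funext i
      rcases Nat.lt_or_ge i L'.length with hi | hi
      · simp [Fin.snoc, hi]
      · simp [Fin.snoc, hi]

end Greedy

/-! ### Multilinear rows -/

namespace PolyRootCSP

variable {F : Type*} [Field F] {d n : ℕ}

/-- The terms of a polynomial with the variables replaced by their numbers, so that the type of
the result does not depend on the number of variables. -/
def PolyExpr.natTerms (p : PolyExpr F n) : List (F × List ℕ) :=
  p.map fun t => (t.1, t.2.map Fin.val)

/-- The sum of the coefficients of the terms in whose monomials exactly the variables in `S`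
occur. -/
def coeffSum (f : List (F × List ℕ)) (S : Finset ℕ) : F :=
  (f.map fun t => if t.2.toFinset = S then t.1 else 0).sum

theorem coeffSum_eq_zero {f : List (F × List ℕ)} {S : Finset ℕ}
    (h : ∀ t ∈ f, t.2.toFinset ≠ S) : coeffSum f S = 0 :=
  List.sum_eq_zero fun x hx => by
    obtain ⟨t, ht, rfl⟩ := List.mem_map.1 hx
    rw [if_neg (h t ht)]

theorem C_mul_prod_X (c : F) (l : List (Fin n)) :
    MvPolynomial.C c * (l.map MvPolynomial.X).prod =
      MvPolynomial.monomial (Multiset.toFinsupp (l : Multiset (Fin n))) c := by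
  induction l generalizing c with
  | nil => simp
  | cons i l ih =>
    rw [List.map_cons, List.prod_cons, mul_left_comm, ih, MvPolynomial.X, MvPolynomial.monomial_mul,
      ← Multiset.cons_coe, ← Multiset.singleton_add, Multiset.toFinsupp_add,
      Multiset.toFinsupp_singleton, one_mul]

theorem sum_coeff_eq_coeffSum (p : PolyExpr F n) (S : Finset (Fin n)) :
    ∑ e ∈ p.toPoly.support with e.support = S, p.toPoly.coeff e =
      coeffSum p.natTerms (S.map Fin.valEmbedding) := by
  -- the left side is the value of a linear functional at the polynomial
  let φ : MvPolynomial (Fin n) F →ₗ[F] F :=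
    (MvPolynomial.basisMonomials (Fin n) F).constr F fun e => if e.support = S then 1 else 0
  have hmon : ∀ e c, φ (MvPolynomial.monomial e c) = if e.support = S then c else 0 := by
    intro e c
    have h := (MvPolynomial.basisMonomials (Fin n) F).constr_basis F
      (fun e => if e.support = S then (1 : F) else 0) e
    rw [MvPolynomial.coe_basisMonomials] at h
    rw [show MvPolynomial.monomial e c = c • MvPolynomial.monomial e (1 : F) by
      rw [MvPolynomial.smul_monomial, smul_eq_mul, mul_one], map_smul]
    simp only [φ]
    rw [h]
    simp
  have hφ : ∀ q : MvPolynomial (Fin n) F,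
      ∑ e ∈ q.support with e.support = S, q.coeff e = φ q := by
    intro q
    conv_rhs => rw [MvPolynomial.as_sum q]
    rw [map_sum, Finset.sum_filter]
    exact Finset.sum_congr rfl fun e _ => (hmon e _).symm
  rw [hφ, PolyExpr.toPoly, map_list_sum, coeffSum, PolyExpr.natTerms, List.map_map, List.map_map]
  congr 1
  refine List.map_congr_left fun t _ => ?_
  simp only [Function.comp_apply]
  rw [C_mul_prod_X, hmon, Multiset.toFinsupp_support]
  have h : (t.2.map Fin.val).toFinset = t.2.toFinset.map Fin.valEmbedding := by
    ext x
    simp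
  simp only [h, Finset.map_inj]
  rfl

theorem multilinearRow_apply (f : Constraint F d n) (S : {S : Finset (Fin n) // S.card ≤ d}) :
    multilinearRow f S = coeffSum f.expr.natTerms (S.1.map Fin.valEmbedding) :=
  sum_coeff_eq_coeffSum f.expr S.1

theorem card_support_le (f : Constraint F d n) {e : Fin n →₀ ℕ} (he : e ∈ f.poly.support) :
    e.support.card ≤ d := by
  refine le_trans ?_ ((MvPolynomial.le_totalDegree he).trans f.degree_le)
  rw [Finset.card_eq_sum_ones]
  exact Finset.sum_le_sum fun i hi => Nat.one_le_iff_ne_zero.2 (Finsupp.mem_support_iff.1 hi)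

/-- Terms of high degree may occur in a constraint, but they cancel out. -/
theorem coeffSum_natTerms_eq_zero (f : Constraint F d n) {S : Finset ℕ}
    (hS : S ∉ Set.range fun S : {S : Finset (Fin n) // S.card ≤ d} =>
      S.1.map Fin.valEmbedding) : coeffSum f.expr.natTerms S = 0 := by
  by_cases h : ∃ S' : Finset (Fin n), S'.map Fin.valEmbedding = S
  · obtain ⟨S', rfl⟩ := h
    rw [← sum_coeff_eq_coeffSum]
    refine Finset.sum_eq_zero fun e he => ?_
    obtain ⟨he', rfl⟩ := Finset.mem_filter.1 he
    exact absurd ⟨⟨_, card_support_le f he'⟩, rfl⟩ hS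
  · refine coeffSum_eq_zero fun t ht hts => h ?_
    obtain ⟨t, -, rfl⟩ := List.mem_map.1 ht
    exact ⟨t.2.toFinset, by rw [← hts]; ext x; simp⟩

/-- The value of a constraint at a 0/1-assignment is a linear function of its multilinear row. -/
theorem eval_eq_sum_multilinearRow (τ : Fin n → Bool) (f : Constraint F d n) :
    MvPolynomial.eval (fun i => if τ i then (1 : F) else 0) f.poly =
      ∑ S : {S : Finset (Fin n) // S.card ≤ d},
        (if ∀ i ∈ S.1, τ i = true then 1 else 0) * multilinearRow f S := by
  have hprod : ∀ e : Fin n →₀ ℕ, (∏ i ∈ e.support, (if τ i then (1 : F) else 0) ^ e i) =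
      if ∀ i ∈ e.support, τ i = true then 1 else 0 := by
    intro e
    split_ifs with h
    · exact Finset.prod_eq_one fun i hi => by simp [h i hi]
    · push Not at h
      obtain ⟨i, hi, hi'⟩ := h
      exact Finset.prod_eq_zero hi (by simp [hi', Finsupp.mem_support_iff.1 hi])
  rw [MvPolynomial.eval_eq]
  simp only [hprod, multilinearRow, Finset.mul_sum, Finset.sum_filter]
  rw [Finset.sum_comm]
  refine Finset.sum_congr rfl fun e he => ?_
  rw [Finset.sum_eq_single ⟨e.support, card_support_le f he⟩]
  · simp
  · intro S _ hS
    have : e.support ≠ S.1 := fun h => hS (Subtype.ext h.symm)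
    simp [this]
  · simp

theorem card_finset_card_le (d n : ℕ) :
    Fintype.card {S : Finset (Fin n) // S.card ≤ d} ≤ n ^ d + 1 := by
  -- a nonempty set of at most `d` elements is the range of a function on `Fin d`
  have h : ∀ S : {S : Finset (Fin n) // S.card ≤ d},
      ∃ f : Option (Fin d → Fin n), S.1 = f.elim ∅ fun f => Finset.univ.image f := by
    rintro ⟨S, hS⟩
    rcases S.eq_empty_or_nonempty with rfl | hne
    · exact ⟨none, rfl⟩
    · obtain ⟨g⟩ : Nonempty (S ↪ Fin d) :=
        Function.Embedding.nonempty_of_card_le (by simpa using hS)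
      have : Nonempty S := hne.to_subtype
      refine ⟨some fun i => (Function.invFun g i).1, ?_⟩
      ext x
      simp only [Option.elim, Finset.mem_image, Finset.mem_univ, true_and]
      constructor
      · exact fun hx => ⟨g ⟨x, hx⟩, by rw [Function.leftInverse_invFun g.injective]⟩
      · rintro ⟨i, rfl⟩
        exact (Function.invFun g i).2
  choose f hf using h
  have hinj : Function.Injective f := fun S S' hSS' => Subtype.ext (by rw [hf S, hf S', hSS'])
  simpa using Fintype.card_le_of_injective f hinj

theorem IsRowBasis.length_le {L' L : List (Constraint F d n)} (h : IsRowBasis L' L) :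
    L'.length ≤ n ^ d + 1 := by
  have := h.1.fintype_card_le_finrank
  rw [Fintype.card_fin, Module.finrank_fintype_fun_eq_card] at this
  exact this.trans (card_finset_card_le d n)

theorem IsRowBasis.satisfiable_iff {L' L : List (Constraint F d n)} (h : IsRowBasis L' L) :
    Satisfiable L' ↔ Satisfiable L := by
  refine exists_congr fun τ => ?_
  let φ : ({S : Finset (Fin n) // S.card ≤ d} → F) →ₗ[F] F :=
    ∑ S, (if ∀ i ∈ S.1, τ i = true then (1 : F) else 0) • LinearMap.proj S
  have key : ∀ L : List (Constraint F d n), (∀ f ∈ L, Satisfies τ f) ↔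
      Submodule.span F (Set.range fun i : Fin L.length => multilinearRow (L.get i)) ≤
        LinearMap.ker φ := by
    intro L
    rw [Submodule.span_le, Set.range_subset_iff, List.forall_mem_iff_get]
    refine forall_congr' fun i => ?_
    rw [Satisfies, eval_eq_sum_multilinearRow]
    simp only [φ, SetLike.mem_coe, LinearMap.mem_ker, LinearMap.sum_apply, LinearMap.smul_apply,
      LinearMap.proj_apply, smul_eq_mul]
  rw [key, key, h.2]

end PolyRootCSP

/-! ### The algorithm -/

namespace PolyRootCSP

open TreeMachine EfficientField

variable {F : Type*}

/-- A list of terms with numbered variables. -/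
abbrev NatExpr (F : Type*) : Type _ := List (F × List ℕ)

/-- The terms of all constraints, each with the position of its constraint. -/
def taggedTerms (L : List (NatExpr F)) : List ((F × List ℕ) × ℕ) :=
  L.zipIdx.flatMap fun x => x.1.map fun t => (t, x.2)

/-- The same variables occur in both lists. -/
def sameVars (a b : List ℕ) : Bool :=
  (a.all fun i => b.any fun k => decide (i = k)) && b.all fun i => a.any fun k => decide (i = k)

/-- The encoding of terms. -/
def encodeTerm (enc : Computability.Encoding F Bool) : F × List ℕ → Val :=
  encodePair (encodeElem enc) (encodeList encodeNat)

theorem polyTime_taggedTerms (enc : Computability.Encoding F Bool) :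
    PolyTime (encodeList (encodeList (encodeTerm enc)))
      (encodeList (encodePair (encodeTerm enc) encodeNat)) taggedTerms :=
  PolyTime.flatMap (F := fun (_ : List (NatExpr F)) (x : NatExpr F × ℕ) =>
      x.1.map fun t => (t, x.2))
    (PolyTime.map (F := fun (y : List (NatExpr F) × NatExpr F × ℕ) t => (t, y.2.2))
      (PolyTime.snd.pair (PolyTime.snd.comp (PolyTime.snd.comp .fst)))
      (PolyTime.fst.comp .snd)) PolyTime.id.zipIdx

theorem polyTime_sameVars {α : Type*} {ea : α → Val} {a b : α → List ℕ}
    (ha : PolyTime ea (encodeList encodeNat) a) (hb : PolyTime ea (encodeList encodeNat) b) :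
    PolyTime ea encodeBit fun x => sameVars (a x) (b x) := by
  have key : ∀ {a b : α → List ℕ}, PolyTime ea (encodeList encodeNat) a →
      PolyTime ea (encodeList encodeNat) b →
      PolyTime ea encodeBit fun x => (a x).all fun i => (b x).any fun k => decide (i = k) :=
    fun ha hb => PolyTime.all (p := fun x i => List.any _ fun k => decide (i = k))
      (PolyTime.any (p := fun y k => decide (y.2 = k))
        ((PolyTime.snd.comp .fst).eq_nat .snd) (hb.comp .fst)) ha
  exact (key ha hb).and (key hb ha)

theorem sameVars_iff {a b : List ℕ} : sameVars a b = true ↔ a.toFinset = b.toFinset := by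
  simp only [sameVars, Bool.and_eq_true, List.all_eq_true, List.any_eq_true, decide_eq_true_eq,
    exists_eq_right', Finset.ext_iff, List.mem_toFinset]
  exact ⟨fun h x => ⟨h.1 x, h.2 x⟩, fun h => ⟨fun x => (h x).1, fun x => (h x).2⟩⟩

variable [Field F]

/-- The matrix with one row for every occurrence of a term and one column for every constraint,
which contains the coefficient of each term in the column of its constraint. -/
def termMatrix (L : List (NatExpr F)) :
    Matrix (Fin (taggedTerms L).length) (Fin L.length) F :=
  fun u j => if (taggedTerms L)[u].2 = j then (taggedTerms L)[u].1.1 else 0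

/-- The 0/1-matrix that tells which occurrences of terms have the same variables. -/
def sameVarsMatrix (L : List (NatExpr F)) :
    Matrix (Fin (taggedTerms L).length) (Fin (taggedTerms L).length) F :=
  fun u v => if sameVars (taggedTerms L)[u].1.2 (taggedTerms L)[v].1.2 then 1 else 0

theorem map_zipIdx_eq_ofFn {α β : Type*} (l : List α) (f : α × ℕ → β) :
    l.zipIdx.map f = List.ofFn fun i : Fin l.length => f (l[i], i) :=
  List.ext_getElem (by simp) fun i _ _ => by simp

theorem map_eq_ofFn {α β : Type*} (l : List α) (f : α → β) :
    l.map f = List.ofFn fun i : Fin l.length => f l[i] :=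
  List.ext_getElem (by simp) fun i _ _ => by simp

/-- The product of the two matrices contains the sums of the coefficients of all terms with the
same variables. -/
theorem sameVarsMatrix_mul_termMatrix (L : List (NatExpr F))
    (u : Fin (taggedTerms L).length) (j : Fin L.length) :
    (sameVarsMatrix L * termMatrix L) u j = coeffSum L[j] (taggedTerms L)[u].1.2.toFinset := by
  obtain ⟨S, hS⟩ : ∃ S, S = (taggedTerms L)[u].1.2.toFinset := ⟨_, rfl⟩
  let w : (F × List ℕ) × ℕ → F := fun t =>
    if t.2 = j then if S = t.1.2.toFinset then t.1.1 else 0 else 0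
  have h1 : (sameVarsMatrix L * termMatrix L) u j =
      ∑ v : Fin (taggedTerms L).length, w (taggedTerms L)[v] := by
    rw [Matrix.mul_apply]
    refine Finset.sum_congr rfl fun v _ => ?_
    simp only [sameVarsMatrix, termMatrix, sameVars_iff, w, hS]
    split_ifs <;> simp
  have h2 : ∀ x : NatExpr F × ℕ, (x.1.map fun t => w (t, x.2)).sum =
      if x.2 = j then coeffSum x.1 S else 0 := by
    intro x
    split_ifs with h <;> simp [w, h, coeffSum, eq_comm (a := S)]
  rw [← hS, h1, ← List.sum_ofFn, ← map_eq_ofFn (taggedTerms L) w, taggedTerms, List.map_flatMap,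
    List.flatMap_def, List.sum_flatten]
  simp only [List.map_map, Function.comp_def, h2]
  rw [map_zipIdx_eq_ofFn, List.sum_ofFn]
  simp [Fin.val_inj]

/-- The matrix to be brought into row echelon form. -/
def testMatrix (L : List (NatExpr F)) : Mat F where
  rows := (taggedTerms L).length + (taggedTerms L).length
  cols := (taggedTerms L).length + L.length
  entries := Matrix.schurBlock (termMatrix L) (sameVarsMatrix L)

theorem ofFn_schurBlock {s t m : ℕ} (D : Matrix (Fin t) (Fin m) F)
    (E : Matrix (Fin s) (Fin t) F) :
    (List.ofFn fun i => List.ofFn fun j => Matrix.schurBlock D E i j) =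
      (List.ofFn fun u : Fin t =>
        (List.ofFn fun v : Fin t => if u = v then (1 : F) else 0) ++ List.ofFn (D u)) ++
      List.ofFn fun u : Fin s => List.ofFn (E u) ++ List.ofFn fun _ : Fin m => (0 : F) := by
  rw [← List.ofFn_fin_append]
  congr 1
  funext i
  refine Fin.addCases (fun u => ?_) (fun u => ?_) i <;>
    simp only [Matrix.schurBlock, Fin.append_left, Fin.append_right, List.ofFn_fin_append]

/-- The positions of the first nonzero entries in the rows of a matrix, which is given by the
list of its rows. -/
def leadingPositions [DecidableEq F] (R : List (List F)) : List ℕ :=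
  R.map fun r => r.findIdx fun x => !decide (x = 0)

/-- The sublist of the constraints whose columns in the test matrix are pivot columns after
Gaussian elimination by `g`. -/
def selectPivots [DecidableEq F]
    (g : ∀ m n : ℕ, Matrix (Fin m) (Fin n) F → Matrix (Fin m) (Fin n) F)
    (L : List (NatExpr F)) : List (NatExpr F) :=
  (L.zipIdx.filter fun x => (leadingPositions (List.ofFn fun i => List.ofFn fun j =>
    g _ _ (testMatrix L).entries i j)).any fun k =>
      decide (k = (taggedTerms L).length + x.2)).map Prod.fst

theorem polyTime_testMatrix (enc : Computability.Encoding F Bool) :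
    PolyTime (encodeList (encodeList (encodeTerm enc))) (encodeMat enc) testMatrix := by
  have hT := (polyTime_taggedTerms enc).zipIdx
  have hJ : PolyTime (encodeList (encodeList (encodeTerm enc))) _ fun L => L.zipIdx :=
    PolyTime.id.zipIdx
  have htop := PolyTime.map
    (F := fun L u => ((taggedTerms L).zipIdx.map fun v =>
        if decide (u.2 = v.2) then (1 : F) else 0) ++
      L.zipIdx.map fun x => if decide (u.1.2 = x.2) then u.1.1.1 else 0)
    ((PolyTime.map (ec := encodeElem enc) (F := fun
        (y : List (NatExpr F) × ((F × List ℕ) × ℕ) × ℕ) v => if decide (y.2.2 = v.2) then 1 else 0)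
      (((PolyTime.snd.comp (PolyTime.snd.comp .fst)).eq_nat (PolyTime.snd.comp .snd)).ite
        (.const 1) (.const 0)) (hT.comp .fst)).append
      (PolyTime.map (F := fun (y : List (NatExpr F) × ((F × List ℕ) × ℕ) × ℕ)
          (x : NatExpr F × ℕ) => if decide (y.2.1.2 = x.2) then y.2.1.1.1 else 0)
        (((PolyTime.snd.comp (PolyTime.fst.comp (PolyTime.snd.comp .fst))).eq_nat
          (PolyTime.snd.comp .snd)).ite
          (PolyTime.fst.comp (PolyTime.fst.comp (PolyTime.fst.comp (PolyTime.snd.comp .fst))))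
          (.const 0)) (hJ.comp .fst))) hT
  have hbot := PolyTime.map
    (F := fun L u => ((taggedTerms L).map fun v =>
        if sameVars u.1.2 v.1.2 then (1 : F) else 0) ++ L.map fun _ => 0)
    ((PolyTime.map (ec := encodeElem enc)
      (F := fun (y : List (NatExpr F) × (F × List ℕ) × ℕ) v =>
        if sameVars y.2.1.2 v.1.2 then 1 else 0)
      ((polyTime_sameVars
        (PolyTime.snd.comp (PolyTime.fst.comp (PolyTime.snd.comp .fst)))
        (PolyTime.snd.comp (PolyTime.fst.comp .snd))).ite (.const 1) (.const 0))
      ((polyTime_taggedTerms enc).comp .fst)).append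
      (PolyTime.map (F := fun _ _ => 0) (.const 0) .fst)) (polyTime_taggedTerms enc)
  have ht := (polyTime_taggedTerms enc).length
  refine ((ht.add_nat ht).pair ((ht.add_nat PolyTime.id.length).pair
    (htop.append hbot))).congr fun L => ?_
  simp only [encodeMat, encodePair, testMatrix]
  congr 3
  rw [ofFn_schurBlock, map_zipIdx_eq_ofFn, map_eq_ofFn]
  simp only [map_zipIdx_eq_ofFn, decide_eq_true_eq, Fin.val_inj]
  simp only [map_eq_ofFn]
  rfl

theorem polyTime_selectPivots [DecidableEq F] (enc : Computability.Encoding F Bool)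
    {g : ∀ m n : ℕ, Matrix (Fin m) (Fin n) F → Matrix (Fin m) (Fin n) F}
    (hg : PolyTime (encodeMat enc) (encodeMat enc)
      fun A : Mat F => ⟨A.rows, A.cols, g A.rows A.cols A.entries⟩) :
    PolyTime (encodeList (encodeList (encodeTerm enc)))
      (encodeList (encodeList (encodeTerm enc))) (selectPivots g) := by
  have hR : PolyTime (encodeList (encodeList (encodeTerm enc)))
      (encodeList (encodeList (encodeElem enc))) fun L => List.ofFn fun i => List.ofFn fun j =>
        g _ _ (testMatrix L).entries i j :=
    PolyTime.snd.comp (PolyTime.snd.comp (f := fun L => (_, _, List.ofFn fun i => List.ofFn fun j =>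
        g _ _ (testMatrix L).entries i j)) ((hg.comp (polyTime_testMatrix enc)).congr
          (ec := encodePair encodeNat (encodePair encodeNat _)) fun L => rfl))
  have hlead := PolyTime.map (F := fun _ r => r.findIdx fun x : F => !decide (x = 0))
    (PolyTime.findIdx (p := fun _ x => !decide (x = 0))
      (PolyTime.snd.eq_elem (.const 0)).not .snd) hR
  exact PolyTime.map (F := fun _ x => x.1) (PolyTime.fst.comp .snd)
    (PolyTime.filter
      (p := fun L x => (leadingPositions (List.ofFn fun i => List.ofFn fun j =>
        g _ _ (testMatrix L).entries i j)).any fun k =>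
          decide (k = (taggedTerms L).length + x.2))
      (PolyTime.any (p := fun (y : List (NatExpr F) × NatExpr F × ℕ) k =>
        decide (k = (taggedTerms y.1).length + y.2.2))
        (PolyTime.snd.eq_nat (((polyTime_taggedTerms enc).length.comp
          (PolyTime.fst.comp .fst)).add_nat (PolyTime.snd.comp (PolyTime.snd.comp .fst))))
        (hlead.comp .fst)) PolyTime.id.zipIdx)

theorem mem_leadingPositions_iff [DecidableEq F] {m n : ℕ} (R : Matrix (Fin m) (Fin n) F)
    (q : Fin n) : (q : ℕ) ∈ leadingPositions (List.ofFn fun i => List.ofFn fun j => R i j) ↔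
      ∃ i, R.IsLeadingEntry i q := by
  simp only [leadingPositions, List.mem_map, List.mem_ofFn]
  constructor
  · rintro ⟨_, ⟨i, rfl⟩, h⟩
    rw [List.findIdx_eq (by simp)] at h
    refine ⟨i, fun k hk => ?_, by simpa using h.1⟩
    simpa using h.2 k hk
  · rintro ⟨i, h, hq⟩
    refine ⟨_, ⟨i, rfl⟩, ?_⟩
    rw [List.findIdx_eq (by simp)]
    exact ⟨by simpa using hq, fun k hk => by simpa using h ⟨k, hk.trans q.2⟩ hk⟩

/-- Gaussian elimination of the test matrix finds the greedy basis of the multilinear rows. -/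
theorem selectPivots_natTerms [DecidableEq F]
    {g : ∀ m n : ℕ, Matrix (Fin m) (Fin n) F → Matrix (Fin m) (Fin n) F}
    (hg : IsGaussianElimination g) {d n : ℕ} (L : List (Constraint F d n)) :
    selectPivots g (L.map fun f => f.expr.natTerms) =
      (L.greedyBasis F multilinearRow).map fun f => f.expr.natTerms := by
  obtain ⟨L', hL'⟩ : ∃ L', L' = L.map fun f => f.expr.natTerms := ⟨_, rfl⟩
  have hlen : L'.length = L.length := by simp [hL']
  have key : ∀ (j : ℕ) (hj : j < L.length), (taggedTerms L').length + j ∈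
      leadingPositions (List.ofFn fun i => List.ofFn fun j =>
        g _ _ (testMatrix L').entries i j) ↔
      multilinearRow L[j] ∉ Submodule.span F (Set.range fun i : Fin (L.take j).length =>
        multilinearRow ((L.take j).get i)) := by
    intro j hj
    obtain ⟨hech, P, hP, hgP⟩ := hg _ _ (testMatrix L').entries
    let q : Fin L'.length := ⟨j, hlen ▸ hj⟩
    rw [hgP] at hech ⊢
    refine (mem_leadingPositions_iff (P * (testMatrix L').entries)
      (Fin.natAdd (taggedTerms L').length q)).trans ?_
    refine (Matrix.exists_isLeadingEntry_mul_iff hP hech _).trans (not_congr ?_)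
    refine (Matrix.col_schurBlock_mem_span_iff _ _ q).trans ?_
    -- both families are restrictions of the coefficient sums over all sets of variables
    let w : Fin L'.length → Finset ℕ → F := fun k => coeffSum L'[k]
    have h1 : ∀ k, (sameVarsMatrix L' * termMatrix L').col k =
        w k ∘ fun u => (taggedTerms L')[u].1.2.toFinset := fun k =>
      funext fun u => sameVarsMatrix_mul_termMatrix L' u k
    have h2 : ∀ k : Fin L'.length, multilinearRow (L[k]'(hlen ▸ k.2)) =
        w k ∘ fun S : {S : Finset (Fin n) // S.card ≤ d} => S.1.map Fin.valEmbedding := fun k =>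
      funext fun S => by simp [w, hL', multilinearRow_apply]
    have h3 : (Set.range fun i : Fin (L.take j).length => multilinearRow ((L.take j).get i)) =
        (fun k : Fin L'.length => w k ∘ fun S : {S : Finset (Fin n) // S.card ≤ d} =>
          S.1.map Fin.valEmbedding) '' Set.Iio q := by
      ext v
      simp only [Set.mem_range, Set.mem_image, Set.mem_Iio, ← h2]
      constructor
      · rintro ⟨i, rfl⟩
        have hi : i < j ∧ i < L.length := by simpa using i.2
        exact ⟨⟨i, hlen ▸ hi.2⟩, hi.1, by simp⟩
      · rintro ⟨k, hk, rfl⟩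
        have hk' : (k : ℕ) < j := hk
        exact ⟨⟨k, by simp; omega⟩, by simp⟩
    rw [h3, show multilinearRow L[j] = _ from h2 q, comp_mem_span_image_iff _ w _ q, h1,
      show (sameVarsMatrix L' * termMatrix L').col = fun k => w k ∘ _ from funext h1,
      comp_mem_span_image_iff _ w _ q]
    · intro k S hS
      refine coeffSum_eq_zero fun t ht hts => hS ?_
      have hmem : (t, (k : ℕ)) ∈ taggedTerms L' := by
        simp only [taggedTerms, List.mem_flatMap, List.mem_map]
        exact ⟨(L'[k], k), by simp [List.mk_mem_zipIdx_iff_getElem?], t, ht, rfl⟩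
      obtain ⟨u, hu, hut⟩ := List.mem_iff_getElem.1 hmem
      exact ⟨⟨u, hu⟩, by simp [hut, hts]⟩
    · intro k S hS
      have := coeffSum_natTerms_eq_zero (L[k]'(hlen ▸ k.2)) hS
      simpa [w, hL'] using this
  classical
  rw [← hL', selectPivots, List.greedyBasis]
  conv_lhs =>
    enter [2, 2]
    rw [hL']
  rw [List.zipIdx_map, List.filter_map, List.map_map, List.map_map]
  refine congrArg₂ List.map rfl (List.filter_congr fun x hx => ?_)
  have hx' := List.mem_zipIdx hx
  have hxL : x.2 < L.length := by omega
  have hk := key x.2 hxL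
  rw [show L[x.2] = x.1 by simpa using hx'.2.2.symm] at hk
  rw [Bool.eq_iff_iff, decide_eq_true_iff, ← hk]
  simp

theorem encodeInst_eq (enc : Computability.Encoding F Bool) {d n : ℕ}
    (L : List (Constraint F d n)) :
    encodePair encodeNat (encodeList (encodeList (encodeTerm enc)))
      (n, L.map fun f => f.expr.natTerms) = encodeInst enc ⟨n, L⟩ := by
  simp only [encodePair, encodeInst, encodeList_map, PolyExpr.natTerms]
  congr 2
  funext f
  simp only [encodeConstraint, encodeTerm, encodePair, encodeList_map]
  rfl

end PolyRootCSP

theorem theorem2 {F : Type*} [Field F] (enc : Computability.Encoding F Bool)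
    (hF : EfficientField.IsEfficient enc) (d : ℕ) :
    ∃ K : ∀ n : ℕ, List (PolyRootCSP.Constraint F d n) → List (PolyRootCSP.Constraint F d n),
      TreeMachine.PolyTime (PolyRootCSP.encodeInst enc) (PolyRootCSP.encodeInst enc)
        (fun I : PolyRootCSP.Inst F d => ⟨I.numVars, K I.numVars I.constraints⟩) ∧
      ∀ (n : ℕ) (L : List (PolyRootCSP.Constraint F d n)),
        (K n L).Sublist L ∧
        (K n L).length ≤ n ^ d + 1 ∧
        (PolyRootCSP.Satisfiable (K n L) ↔ PolyRootCSP.Satisfiable L) ∧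
        PolyRootCSP.IsRowBasis (K n L) L := by
  classical
  obtain ⟨g, hg, hgt⟩ := hF.gauss
  refine ⟨fun n L => L.greedyBasis F PolyRootCSP.multilinearRow, ?_, fun n L => ?_⟩
  · refine (TreeMachine.PolyTime.fst.pair
      ((PolyRootCSP.polyTime_selectPivots enc hgt).comp TreeMachine.PolyTime.snd)).recode
      (fun I : PolyRootCSP.Inst F d => (I.numVars, I.constraints.map fun f => f.expr.natTerms))
      (fun I => PolyRootCSP.encodeInst_eq enc I.constraints) fun I => ?_
    rw [PolyRootCSP.selectPivots_natTerms hg]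
    exact PolyRootCSP.encodeInst_eq enc _
  · have hbasis : PolyRootCSP.IsRowBasis (L.greedyBasis F PolyRootCSP.multilinearRow) L :=
      L.greedyBasis_spec PolyRootCSP.multilinearRow
    exact ⟨L.greedyBasis_sublist PolyRootCSP.multilinearRow, hbasis.length_le,
      hbasis.satisfiable_iff, hbasis⟩
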